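/- **Setting.** A binary input memoryless channel (BIMC) is given by two transition densities (pmf's or pdf's) $p(y|0),p(y|1)$ with respect to a common reference measure on an output space $\mathcal Y$; a block $x^n\in\{0,1\}^n$ produces an output block with independent components of densities $p(\cdot|x_i)$. Let $X$ be a uniform input bit, $Y$ the corresponding output, $p(x|y)=p(y|x)/(p(y|0)+p(y|1))$, and let $\mathbf E$ refer to the law of $(X,Y)$. All logarithms are natural. Put $H=H(X|Y)=\mathbf E[-\ln p(X|Y)]$, $C_{\mathrm{BIMC-L}}=\ln 2-H$, $\Lambda(\lambda)=\mathbf E[p(X|Y)^{-\lambda}]\in(0,\infty]$, $$\lambda^*=\sup\{\lambda\ge 0:\Lambda(\lambda)<\infty\},\qquad r(\delta)=\sup_{\lambda\ge 0}\bigl[\lambda(H+\delta)-\ln\Lambda(\lambda)\bigr],$$ and, for $0\le\lambda<\lambda^*$, $f_\lambda(x,y)=p(x|y)^{-\lambda}/\Lambda(\lambda)$, $\delta(\lambda)=\mathbf E[f_\lambda(X,Y)(-\ln p(X|Y))]-H$, $$\sigma_H^2(\lambda)=\mathbf E\bigl[f_\lambda(X,Y)\,|-\ln p(X|Y)-H-\delta(\lambda)|^2\bigr],\qquad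 M_H(\lambda)=\mathbf E\bigl[f_\lambda(X,Y)\,|-\ln p(X|Y)-H-\delta(\lambda)|^3\bigr],$$ $\sigma_H=\sigma_H(0)$, $M_H=M_H(0)$, $\Delta^*=\lim_{\lambda\uparrow\lambda^*}\delta(\lambda)\in(-\infty,\infty]$. Let $Q(s)=\frac1{\sqrt{2\pi}}\int_s^\infty e^{-x^2/2}dx$, and let $C$ be any real number not smaller than the Berry–Esseen constant, the infimum of all $K$ such that, for every $m\ge1$, every real $t$ and all i.i.d. centred $V_1,\dots,V_m$ with variance $\sigma^2>0$ and $\mathbf E|V_1|^3<\infty$, $|\Pr\{\sum_i V_i>t\sigma\sqrt m\}-Q(t)|\le K\,\mathbf E|V_1|^3/(\sqrt m\,\sigma^3)$. (That constant is known to be less than $0.4784$.) Put $$\bar\xi_H(\lambda,n)=\frac{2CM_H(\lambda)}{\sqrt n\,\sigma_H^3(\lambda)}+e^{n\lambda^2\sigma_H^2(\lambda)/2}\bigl[Q(\sqrt n\lambda\sigma_H(\lambda))-Q(\rho^*+\sqrt n\lambda\sigma_H(\lambda))\bigr],\quad Q(\rho^*)=\min\Bigl\{\frac{CM_H(\lambda)}{\sqrt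 n\,\sigma_H^3(\lambda)},\frac12\Bigr\}.$$ **Code and decoder.** Let $1\le k\le n$. Draw a parity check matrix $\mathbf H\in\mathbb F_2^{(n-k)\times n}$ with independent uniform entries; the codewords are the nonzero vectors $x^n$ with $\mathbf Hx^n=0$ (the message $0$ is punctured). A uniformly chosen codeword is sent. A jar decoder with parameter $\delta\in\mathbb R$ forms $$J(y^n)=\Bigl\{x^n:-\tfrac1n\ln\frac{p(y^n|x^n)}{\prod_{i=1}^n[p(y_i|0)+p(y_i|1)]}\le H+\delta\Bigr\},$$ declares an error if $J(y^n)$ contains no codeword, and otherwise outputs an arbitrary codeword in $J(y^n)$. Let $P_e$ be the word error probability, averaged over message, channel and $\mathbf H$, and let $\mathcal R=\frac kn\ln 2$. **Theorem 2.** For every BIMC with $\sigma_H^2>0$, $\lambda^*>0$ and $M_H<\infty$, the limit $\Delta^*$ exists, and for all $1\le k\le n$ and every tie-breaking rule: 1. Let $\delta\in(0,\Delta^*)$. Then $r$ is finite and differentiable at $\delta$, $\lambda:=r'(\delta)\in(0,\lambda^*)$, and jar decoding with parameter $\delta$ satisfies $$P_e\le\Bigl(\frac1{1-2^{-n}}+\lambda\Bigr)\bar\xi_H(\lambda,n)\,e^{-nr(\delta)}\quad\text{whenever}\quad\mathcal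 R\le C_{\mathrm{BIMC-L}}-\delta-r(\delta)+\frac{\ln(\lambda\,\bar\xi_H(\lambda,n))}n .$$ 2. For every real $c$, jar decoding with parameter $c/\sqrt n$ satisfies $$P_e\le\frac1{1-2^{-n}}Q\Bigl(\frac c{\sigma_H}\Bigr)+\frac1{\sqrt n}\Bigl(\frac{CM_H}{\sigma_H^3}+\frac{e^{-c^2/(2\sigma_H^2)}}{\sqrt{2\pi}\,\sigma_H}\Bigr)$$ whenever $$\mathcal R\le C_{\mathrm{BIMC-L}}-\frac c{\sqrt n}-\frac{\ln n}{2n}-\frac{\frac{c^2}{2\sigma_H^2}+\ln(\sqrt{2\pi}\,\sigma_H)}n .$$ -/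

import Mathlib

open MeasureTheory Filter Topology
open scoped ENNReal NNReal Matrix

noncomputable section

/-! ### Gaussian tail and the Berry-Esseen constant -/

/-- The Gaussian tail `Q(s) = (2π)^(-1/2) ∫_s^∞ exp(-x²/2) dx`. -/
def gaussQ (s : ℝ) : ℝ :=
  1 / Real.sqrt (2 * Real.pi) * ∫ x in Set.Ioi s, Real.exp (-x ^ 2 / 2)

/-- `K` is admissible in the Berry-Esseen inequality for independent identically distributed
summands: for every centred law `ν` on `ℝ` with positive variance and finite third absolute
moment, every number `n ≥ 1` of summands and every real `t`. -/
def IsBerryEsseenConst (K : ℝ) : Prop :=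
  ∀ ν : Measure ℝ, IsProbabilityMeasure ν →
    Integrable (fun v : ℝ => |v| ^ 3) ν → ∫ v, v ∂ν = 0 → 0 < ∫ v, v ^ 2 ∂ν →
    ∀ n : ℕ, 1 ≤ n → ∀ t : ℝ,
      |(Measure.pi (fun _ : Fin n => ν)).real
          {v | t * (Real.sqrt n * Real.sqrt (∫ u, u ^ 2 ∂ν)) < ∑ i, v i} - gaussQ t|
        ≤ K * (∫ u, |u| ^ 3 ∂ν) / (Real.sqrt n * Real.sqrt (∫ u, u ^ 2 ∂ν) ^ 3)

/-- The (optimal) universal constant of the Berry-Esseen theorem for i.i.d. summands. -/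
def berryEsseenConst : ℝ := sInf {K : ℝ | IsBerryEsseenConst K}

/-! ### Binary input memoryless channels -/

/-- A binary input memoryless channel with output space `Y`: a reference measure on `Y` (counting
measure for a pmf, Lebesgue measure for a pdf, for example) and the two transition densities
`p(· | 0)`, `p(· | 1)` with respect to it. -/
structure BIMC (Y : Type*) [MeasurableSpace Y] where
  /-- reference measure -/
  ref : Measure Y
  /-- `dens x y = p(y | x)` -/
  dens : ZMod 2 → Y → ℝ≥0
  measurable_dens : ∀ x, Measurable (dens x)
  lintegral_dens : ∀ x, ∫⁻ y, (dens x y : ℝ≥0∞) ∂ref = 1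

namespace BIMC

variable {Y : Type*} [MeasurableSpace Y] (W : BIMC Y)

/-- The law of the channel output when the input is `x`. -/
def out (x : ZMod 2) : Measure Y := W.ref.withDensity (fun y => (W.dens x y : ℝ≥0∞))

instance (x : ZMod 2) : IsProbabilityMeasure (W.out x) :=
  ⟨by rw [out, withDensity_apply _ MeasurableSet.univ, Measure.restrict_univ, W.lintegral_dens x]⟩

/-- The law of the channel output block when the input block is `x` (memoryless channel). -/
def outBlock {n : ℕ} (x : Fin n → ZMod 2) : Measure (Fin n → Y) :=
  Measure.pi (fun i => W.out (x i))

/-- The joint law of `(X, Y)` for a uniform input `X`. -/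
def joint : Measure (ZMod 2 × Y) :=
  (2 : ℝ≥0∞)⁻¹ • ∑ x : ZMod 2, (W.out x).map (fun y => (x, y))

/-- The posterior probability `p(x | y) = p(y | x) / (p(y | 0) + p(y | 1))`. -/
def post (x : ZMod 2) (y : Y) : ℝ := (W.dens x y : ℝ) / ((W.dens 0 y : ℝ) + (W.dens 1 y : ℝ))

/-- `-ln p(x | y)`; under the joint law, `p(x | y) > 0` almost surely. -/
def info (z : ZMod 2 × Y) : ℝ := -Real.log (W.post z.1 z.2)

/-- The conditional entropy `H(X | Y)` in nats. -/
def condEntropy : ℝ := ∫ z, W.info z ∂W.joint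

/-- The linear capacity `ln 2 - H(X | Y)` in nats. -/
def linCapacity : ℝ := Real.log 2 - W.condEntropy

/-- `∬ p(y) p(x | y)^(1 - l) dx dy`, that is, the expectation of `p(X | Y)^(-l)`; it may be `∞`. -/
def partition (l : ℝ) : ℝ≥0∞ :=
  ∫⁻ z, ENNReal.ofReal (W.post z.1 z.2 ^ (-l)) ∂W.joint

/-- `λ*(X | Y)`, as an extended real number. -/
def lamStar : EReal := sSup ((fun l : ℝ => (l : EReal)) '' {l : ℝ | 0 ≤ l ∧ W.partition l < ∞})

/-- `r_{X | Y}(d)` as an extended real number; parameters `l` for which the integral is infinite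
contribute `-∞` to the supremum. -/
def rateE (d : ℝ) : EReal :=
  ⨆ l : {l : ℝ // 0 ≤ l},
    ((l.1 * (W.condEntropy + d) : ℝ) : EReal) - ENNReal.log (W.partition l.1)

/-- `r_{X | Y}(d)` as a real number (where it is finite). -/
def rate (d : ℝ) : ℝ := (W.rateE d).toReal

/-- The tilting factor `f_l(x, y)`. -/
def tilt (l : ℝ) (z : ZMod 2 × Y) : ℝ := W.post z.1 z.2 ^ (-l) / (W.partition l).toReal

/-- The function `δ(l)`. -/
def delta (l : ℝ) : ℝ := (∫ z, W.tilt l z * W.info z ∂W.joint) - W.condEntropy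

/-- `σ_H²(X | Y, l)`. -/
def sigmaSq (l : ℝ) : ℝ :=
  ∫ z, W.tilt l z * |W.info z - (W.condEntropy + W.delta l)| ^ 2 ∂W.joint

/-- `σ_H(X | Y, l)`. -/
def sigma (l : ℝ) : ℝ := Real.sqrt (W.sigmaSq l)

/-- `M_H(X | Y, l)`, possibly infinite. -/
def thirdMoment (l : ℝ) : ℝ≥0∞ :=
  ∫⁻ z, ENNReal.ofReal (W.tilt l z * |W.info z - (W.condEntropy + W.delta l)| ^ 3) ∂W.joint

/-- Real parameters tending to `λ*(X | Y)` from below. -/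
def toLamStar : Filter ℝ := comap (fun l : ℝ => (l : EReal)) (𝓝[<] W.lamStar)

/-- `Δ*(X | Y)`, the limit of `δ(l)` as `l ↑ λ*(X | Y)`, as an extended real number. It is written
as an upper limit so that it is defined without a proof that the limit exists. -/
def DeltaStar : EReal := limsup (fun l : ℝ => (W.delta l : EReal)) W.toLamStar

/-- The Berry-Esseen term `C M_H(X | Y, l) / (√n σ_H³(X | Y, l))`. -/
def beTerm (C l : ℝ) (n : ℕ) : ℝ :=
  C * (W.thirdMoment l).toReal / (Real.sqrt n * W.sigma l ^ 3)

/-- `ρ* ≥ 0`, the point at which `Q` equals the Berry-Esseen term, or `1/2 = Q(0)` if that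
term exceeds `1/2`. -/
def rhoStar (C l : ℝ) (n : ℕ) : ℝ := Function.invFun gaussQ (min (W.beTerm C l n) (1 / 2))

/-- `ξ̄_H(X | Y, l, n)`. -/
def xiBar (C l : ℝ) (n : ℕ) : ℝ :=
  2 * C * (W.thirdMoment l).toReal / (Real.sqrt n * W.sigma l ^ 3)
    + Real.exp (n * l ^ 2 * W.sigmaSq l / 2)
      * (gaussQ (Real.sqrt n * l * W.sigma l)
          - gaussQ (W.rhoStar C l n + Real.sqrt n * l * W.sigma l))

/-! ### Gallager's parity check ensemble and jar decoding -/

/-- The jar `J(y)` with parameter `d`. With `-ln 0 = ∞`, membership includes that the likelihood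
of `x` is positive. -/
def jar (d : ℝ) {n : ℕ} (y : Fin n → Y) : Set (Fin n → ZMod 2) :=
  {x | 0 < (∏ i, (W.dens (x i) (y i) : ℝ)) / ∏ i, ((W.dens 0 (y i) : ℝ) + (W.dens 1 (y i) : ℝ)) ∧
    -(1 / (n : ℝ)) * Real.log
        ((∏ i, (W.dens (x i) (y i) : ℝ)) / ∏ i, ((W.dens 0 (y i) : ℝ) + (W.dens 1 (y i) : ℝ)))
      ≤ W.condEntropy + d}

end BIMC

/-- The codewords of the linear code with parity check matrix `H`, the zero word (the codeword of
the message `0`, which is first in lexicographic order) being punctured. -/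
def codewords {m n : ℕ} (H : Matrix (Fin m) (Fin n) (ZMod 2)) : Finset (Fin n → ZMod 2) :=
  Finset.univ.filter (fun x => H *ᵥ x = 0 ∧ x ≠ 0)

/-- A decoder for codes with `m` parity checks: it knows the parity check matrix and the channel
output, and returns a word, or `none` for a declared error. -/
abbrev Decoder (Y : Type*) (m n : ℕ) : Type _ :=
  Matrix (Fin m) (Fin n) (ZMod 2) → (Fin n → Y) → Option (Fin n → ZMod 2)

namespace BIMC

variable {Y : Type*} [MeasurableSpace Y] (W : BIMC Y)

/-- `g` is a jar decoder with parameter `d`: it declares an error if no codeword lies in the jar,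
and otherwise returns some codeword in the jar (ties being broken in an arbitrary way). -/
def IsJarDecoder (d : ℝ) {m n : ℕ} (g : Decoder Y m n) : Prop :=
  ∀ H y,
    ((∀ x ∈ codewords H, x ∉ W.jar d y) → g H y = none) ∧
    ((∃ x ∈ codewords H, x ∈ W.jar d y) → ∃ x ∈ codewords H, x ∈ W.jar d y ∧ g H y = some x)

/-- Average word error probability with decoder `g` for block length `n` and `m` parity checks: the
average over a uniform parity check matrix, a uniform (non-zero) codeword of its code, and the
channel output. -/
def avgError {m n : ℕ} (g : Decoder Y m n) : ℝ :=
  (Fintype.card (Matrix (Fin m) (Fin n) (ZMod 2)) : ℝ)⁻¹ *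
    ∑ H : Matrix (Fin m) (Fin n) (ZMod 2),
      ((codewords H).card : ℝ)⁻¹ *
        ∑ x ∈ codewords H, (W.outBlock x).real {y | g H y ≠ some x}

end BIMC

/-- The design rate `(k / n) ln 2` of the ensemble, in nats. -/
def designRate (n k : ℕ) : ℝ := (k : ℝ) / (n : ℝ) * Real.log 2

end

noncomputable section

/-! ### The Gaussian tail -/

/-! A jar decoder can fail only if the sent word leaves the jar or a second codeword enters it. The
posteriors of all words given an output block sum to at most 1, and each word in the jar has
posterior at least `exp (-n (H + δ))`, so a jar holds at most `exp (n (H + δ))` words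
(`card_jar_le`). The general linear group over `ZMod 2` is 2-transitive on nonzero vectors. Hence
the probability that `x` is sent while `x'` is another codeword does not depend on the pair, and
double counting evaluates it even though the number of codewords is random (`pairWeight_mul`). The
union bound then gives `avgError_le`: the error is at most the probability that the information sum
exceeds `n (H + δ)`, plus `2 ^ (-(n - k)) * exp (n (H + δ))`. The rate conditions are exactly the
upper bounds wanted for this second term.

For the first term with `δ > 0`, the law of the information density is tilted so that its mean
becomes `H + δ`. Undoing the tilt leaves `exp (-n r(δ))` times the expectation of `exp (-a V)` over
`V > 0`, where `V` is a standardized sum. Writing that exponential as the tail of an independent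
exponential variable reduces it to probabilities of intervals, and the normal approximation with its
error produces the factor `xiBar` (`integral_indicator_exp_le`, `pi_real_sum_gt_le`). For `δ = c /
√n` the normal approximation is applied without a tilt.

The parameter comes from the cumulant generating function: `delta` is its derivative minus `H`, with
derivative `sigmaSq > 0`. So `delta` increases strictly from 0 at `λ = 0`, its limit is its
supremum, and every `δ` in `(0, Δ*)` is attained. Tangent lines of the convex cumulant generating
function evaluate the Legendre transform there and squeeze its difference quotients, giving `r' =
λ`.

An infimum of an empty set of reals would carry no information, so the Berry-Esseen theorem is
proved with some finite constant, by Fejér smoothing and characteristic functions. The infimum is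
itself admissible because the inequality is closed in the constant. -/

lemma integrable_exp_neg_sq_div_two : Integrable (fun x : ℝ => Real.exp (-x ^ 2 / 2)) := by
  have := integrable_exp_neg_mul_sq (b := 1 / 2) (by norm_num)
  refine this.congr (ae_of_all _ fun x => ?_)
  simp only
  congr 1
  ring

lemma gaussQ_eq_gaussianReal (s : ℝ) :
    gaussQ s = (ProbabilityTheory.gaussianReal 0 1).real (Set.Ioi s) := by
  rw [Measure.real, ProbabilityTheory.gaussianReal_apply_eq_integral 0 one_ne_zero,
    ENNReal.toReal_ofReal
      (integral_nonneg fun x => ProbabilityTheory.gaussianPDFReal_nonneg 0 1 x),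
    gaussQ, ← integral_const_mul]
  refine integral_congr_ae (ae_of_all _ fun x => ?_)
  simp [ProbabilityTheory.gaussianPDFReal_def]

lemma gaussQ_sub_eq (s t : ℝ) :
    gaussQ s - gaussQ t
      = 1 / Real.sqrt (2 * Real.pi) * ∫ x in s..t, Real.exp (-x ^ 2 / 2) := by
  rw [gaussQ, gaussQ, ← mul_sub, intervalIntegral.integral_Ioi_sub_Ioi']
  · exact integrable_exp_neg_sq_div_two.integrableOn
  · exact integrable_exp_neg_sq_div_two.integrableOn

lemma hasDerivAt_gaussQ (s : ℝ) :
    HasDerivAt gaussQ (-(1 / Real.sqrt (2 * Real.pi) * Real.exp (-s ^ 2 / 2))) s := by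
  have h1 : gaussQ = fun t => gaussQ 0
      - 1 / Real.sqrt (2 * Real.pi) * ∫ x in (0 : ℝ)..t, Real.exp (-x ^ 2 / 2) := by
    funext t
    rw [← gaussQ_sub_eq]
    ring
  rw [h1]
  have hc : Continuous fun x : ℝ => Real.exp (-x ^ 2 / 2) := by fun_prop
  exact ((hc.integral_hasStrictDerivAt 0 s).hasDerivAt.const_mul _).const_sub _

lemma continuous_gaussQ : Continuous gaussQ :=
  continuous_iff_continuousAt.2 fun s => (hasDerivAt_gaussQ s).continuousAt

lemma strictAnti_gaussQ : StrictAnti gaussQ := by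
  refine strictAnti_of_deriv_neg fun s => ?_
  rw [(hasDerivAt_gaussQ s).deriv, neg_lt_zero]
  positivity

lemma gaussQ_pos (s : ℝ) : 0 < gaussQ s := by
  have h := strictAnti_gaussQ (lt_add_one s)
  have : 0 ≤ gaussQ (s + 1) := by rw [gaussQ_eq_gaussianReal]; exact measureReal_nonneg
  linarith

lemma gaussQ_zero : gaussQ 0 = 1 / 2 := by
  have h := integral_gaussian_Ioi (1 / 2)
  have h2 : ∫ x in Set.Ioi (0 : ℝ), Real.exp (-x ^ 2 / 2) = √(Real.pi / (1 / 2)) / 2 := by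
    rw [← h]
    congr 1
    funext x
    congr 1
    ring
  rw [gaussQ, h2]
  have h3 : Real.pi / (1 / 2) = 2 * Real.pi := by ring
  have : √(2 * Real.pi) ≠ 0 := by positivity
  rw [h3]
  field_simp

lemma tendsto_gaussQ_atTop : Tendsto gaussQ atTop (𝓝 0) := by
  have h := tendsto_measure_iInter_atTop (μ := ProbabilityTheory.gaussianReal 0 1)
    (s := fun s : ℝ => Set.Ioi s) (fun s => measurableSet_Ioi.nullMeasurableSet)
    (fun a b hab => Set.Ioi_subset_Ioi hab) ⟨0, measure_ne_top _ _⟩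
  have h2 : (⋂ s : ℝ, Set.Ioi s) = ∅ := by
    ext x
    simp only [Set.mem_iInter, Set.mem_Ioi, Set.mem_empty_iff_false, iff_false, not_forall]
    exact ⟨x, lt_irrefl x⟩
  rw [h2, measure_empty] at h
  have h3 := (ENNReal.tendsto_toReal ENNReal.zero_ne_top).comp h
  refine h3.congr fun s => ?_
  rw [gaussQ_eq_gaussianReal]
  rfl

lemma exists_gaussQ_eq {b : ℝ} (hb : 0 < b) (hb' : b ≤ 1 / 2) : ∃ s, gaussQ s = b := by
  obtain ⟨t, ht⟩ := (tendsto_gaussQ_atTop.eventually (gt_mem_nhds hb)).exists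
  have := intermediate_value_uIcc (a := 0) (b := t) continuous_gaussQ.continuousOn
  have hm : b ∈ Set.uIcc (gaussQ 0) (gaussQ t) := by
    rw [Set.mem_uIcc, gaussQ_zero]
    exact Or.inr ⟨ht.le, hb'⟩
  obtain ⟨s, -, hs⟩ := this hm
  exact ⟨s, hs⟩

lemma gaussQ_sub_le {s t : ℝ} (h : s ≤ t) : gaussQ s - gaussQ t ≤ t - s := by
  rw [gaussQ_sub_eq]
  have h1 : ∫ x in s..t, Real.exp (-x ^ 2 / 2) ≤ ∫ _ in s..t, (1 : ℝ) := by
    refine intervalIntegral.integral_mono_on h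
      integrable_exp_neg_sq_div_two.intervalIntegrable (by simp) fun x _ => ?_
    rw [Real.exp_le_one_iff]
    nlinarith [sq_nonneg x]
  have h0 : 0 ≤ ∫ x in s..t, Real.exp (-x ^ 2 / 2) :=
    intervalIntegral.integral_nonneg h fun x _ => (Real.exp_pos _).le
  have h2 : 1 / √(2 * Real.pi) ≤ 1 := by
    rw [div_le_one (by positivity), Real.one_le_sqrt]
    linarith [Real.pi_gt_three]
  rw [intervalIntegral.integral_const, smul_eq_mul, mul_one] at h1
  calc _ ≤ 1 * ∫ x in s..t, Real.exp (-x ^ 2 / 2) := by gcongr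
    _ ≤ _ := by linarith

/-! ### Characteristic function estimates -/

lemma norm_cexp_mul_I_sub_le (x : ℝ) :
    ‖Complex.exp (x * Complex.I) - (1 + x * Complex.I - x ^ 2 / 2)‖ ≤ 4 * |x| ^ 3 := by
  have hn : ‖(x : ℂ) * Complex.I‖ = |x| := by simp
  rcases le_or_gt |x| 1 with h | h
  · have := Complex.exp_bound (x := x * Complex.I) (by rw [hn]; exact h) (n := 3) (by norm_num)
    have hs : ∑ m ∈ Finset.range 3, ((x : ℂ) * Complex.I) ^ m / (m.factorial : ℂ)
        = 1 + x * Complex.I - x ^ 2 / 2 := by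
      simp only [Finset.sum_range_succ, Finset.range_one, Finset.sum_singleton, mul_pow,
        Complex.I_sq, Nat.factorial]
      push_cast
      ring
    rw [hs, hn] at this
    refine this.trans ?_
    norm_num [Nat.factorial]
    nlinarith [pow_nonneg (abs_nonneg x) 3]
  · have h1 : ‖Complex.exp (x * Complex.I)‖ = 1 := Complex.norm_exp_ofReal_mul_I x
    have h2 : ‖(1 + x * Complex.I - x ^ 2 / 2 : ℂ)‖ ≤ 1 + |x| + |x| ^ 2 / 2 := by
      refine (norm_sub_le _ _).trans (add_le_add ((norm_add_le _ _).trans ?_) ?_)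
      · rw [hn]; simp
      · simp
    refine (norm_sub_le _ _).trans ?_
    rw [h1]
    nlinarith [mul_pos (sub_pos.2 h) (sub_pos.2 h), pow_pos (zero_lt_one.trans h) 2,
      pow_pos (zero_lt_one.trans h) 3, mul_pos (pow_pos (zero_lt_one.trans h) 2) (sub_pos.2 h)]

lemma integrable_id_of_integrable_abs_pow_three {ν : Measure ℝ} [IsFiniteMeasure ν]
    (h : Integrable (fun v : ℝ => |v| ^ 3) ν) : Integrable (fun v : ℝ => v) ν := by
  refine (h.add (integrable_const 1)).mono' (by fun_prop) (ae_of_all _ fun v => ?_)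
  simp only [Pi.add_apply, Real.norm_eq_abs]
  nlinarith [abs_nonneg v, sq_nonneg (|v| - 1), mul_nonneg (abs_nonneg v) (sq_nonneg (|v| - 1))]

lemma integrable_sq_of_integrable_abs_pow_three {ν : Measure ℝ} [IsFiniteMeasure ν]
    (h : Integrable (fun v : ℝ => |v| ^ 3) ν) : Integrable (fun v : ℝ => v ^ 2) ν := by
  refine (h.add (integrable_const 1)).mono' (by fun_prop) (ae_of_all _ fun v => ?_)
  simp only [Pi.add_apply, norm_pow, Real.norm_eq_abs]
  nlinarith [abs_nonneg v, sq_nonneg (|v| - 1), mul_nonneg (abs_nonneg v) (sq_nonneg (|v| - 1))]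

/-- Integrate the second-order Taylor bound for `exp (i s v)`; centring and unit variance determine
the linear and quadratic terms. -/
lemma norm_charFun_sub_le {ν : Measure ℝ} [IsProbabilityMeasure ν]
    (h3 : Integrable (fun v : ℝ => |v| ^ 3) ν) (h0 : ∫ v, v ∂ν = 0) (h2 : ∫ v, v ^ 2 ∂ν = 1)
    (s : ℝ) :
    ‖charFun ν s - (1 - s ^ 2 / 2 : ℝ)‖ ≤ 4 * (∫ v, |v| ^ 3 ∂ν) * |s| ^ 3 := by
  have i1 := integrable_id_of_integrable_abs_pow_three h3
  have i2 := integrable_sq_of_integrable_abs_pow_three h3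
  have j1 : Integrable (fun v : ℝ => ((s * v : ℝ) : ℂ) * Complex.I) ν :=
    ((i1.const_mul s).ofReal).mul_const _
  have j2 : Integrable (fun v : ℝ => ((s * v : ℝ) : ℂ) ^ 2 / 2) ν := by
    have := ((i2.const_mul (s ^ 2)).ofReal (𝕜 := ℂ)).div_const 2
    refine this.congr (ae_of_all _ fun v => ?_)
    simp [mul_pow]
  have j0 : Integrable (fun v : ℝ => Complex.exp (((s * v : ℝ) : ℂ) * Complex.I)) ν := by
    refine (integrable_const (1 : ℝ)).mono' (by fun_prop) (ae_of_all _ fun v => ?_)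
    rw [Complex.norm_exp_ofReal_mul_I]
  have e1 : ∫ v : ℝ, ((s * v : ℝ) : ℂ) * Complex.I ∂ν = 0 := by
    rw [integral_mul_const, integral_complex_ofReal, integral_const_mul, h0]
    simp
  have e2 : ∫ v : ℝ, ((s * v : ℝ) : ℂ) ^ 2 / 2 ∂ν = ((s ^ 2 / 2 : ℝ) : ℂ) := by
    have : ∀ v : ℝ, ((s * v : ℝ) : ℂ) ^ 2 / 2 = ((s ^ 2 / 2 * v ^ 2 : ℝ) : ℂ) := fun v => by
      push_cast
      ring
    simp_rw [this]
    rw [integral_complex_ofReal, integral_const_mul, h2, mul_one]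
  have j3 : Integrable (fun v : ℝ => (1 : ℂ) + ((s * v : ℝ) : ℂ) * Complex.I) ν :=
    (integrable_const _).add j1
  have j4 : Integrable (fun v : ℝ => (1 : ℂ) + ((s * v : ℝ) : ℂ) * Complex.I
      - ((s * v : ℝ) : ℂ) ^ 2 / 2) ν := j3.sub j2
  have key : charFun ν s - (1 - s ^ 2 / 2 : ℝ)
      = ∫ v : ℝ, (Complex.exp (((s * v : ℝ) : ℂ) * Complex.I)
        - (1 + ((s * v : ℝ) : ℂ) * Complex.I - ((s * v : ℝ) : ℂ) ^ 2 / 2)) ∂ν := by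
    rw [integral_sub j0 j4, integral_sub j3 j2, integral_add (integrable_const _) j1,
      e1, e2, charFun_apply_real]
    simp
  rw [key]
  refine (norm_integral_le_integral_norm _).trans ?_
  calc ∫ v : ℝ, ‖Complex.exp (((s * v : ℝ) : ℂ) * Complex.I)
        - (1 + ((s * v : ℝ) : ℂ) * Complex.I - ((s * v : ℝ) : ℂ) ^ 2 / 2)‖ ∂ν
      ≤ ∫ v : ℝ, 4 * |s| ^ 3 * |v| ^ 3 ∂ν := by
        refine integral_mono_of_nonneg (ae_of_all _ fun v => norm_nonneg _) (h3.const_mul _)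
          (ae_of_all _ fun v => ?_)
        refine (norm_cexp_mul_I_sub_le (s * v)).trans (le_of_eq ?_)
        rw [abs_mul, mul_pow]
        ring
    _ = _ := by
        rw [integral_const_mul]
        ring

lemma one_le_integral_abs_pow_three {ν : Measure ℝ} [IsProbabilityMeasure ν]
    (h3 : Integrable (fun v : ℝ => |v| ^ 3) ν) (h2 : ∫ v, v ^ 2 ∂ν = 1) :
    1 ≤ ∫ v, |v| ^ 3 ∂ν := by
  have i2 := integrable_sq_of_integrable_abs_pow_three h3
  have : ∫ v, (3 / 2 * v ^ 2 - 1 / 2) ∂ν ≤ ∫ v, |v| ^ 3 ∂ν := by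
    refine integral_mono ((i2.const_mul _).sub (integrable_const _)) h3 fun v => ?_
    simp only
    rw [← sq_abs v]
    nlinarith [abs_nonneg v, mul_nonneg (abs_nonneg v) (sq_nonneg (|v| - 1)),
      sq_nonneg (|v| - 1)]
  rw [integral_sub (i2.const_mul _) (integrable_const _), integral_const_mul, h2] at this
  simp at this
  linarith

lemma norm_pow_sub_pow_le {a b : ℂ} {r : ℝ} (ha : ‖a‖ ≤ r) (hb : ‖b‖ ≤ r) (n : ℕ) :
    ‖a ^ n - b ^ n‖ ≤ n * r ^ (n - 1) * ‖a - b‖ := by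
  have hr : 0 ≤ r := (norm_nonneg a).trans ha
  rw [(Commute.all a b).mul_geom_sum₂ n |>.symm, norm_mul, mul_comm]
  gcongr
  refine (norm_sum_le _ _).trans ?_
  calc ∑ i ∈ Finset.range n, ‖a ^ i * b ^ (n - 1 - i)‖
      ≤ ∑ _i ∈ Finset.range n, r ^ (n - 1) := by
        refine Finset.sum_le_sum fun i hi => ?_
        rw [norm_mul, norm_pow, norm_pow]
        calc ‖a‖ ^ i * ‖b‖ ^ (n - 1 - i) ≤ r ^ i * r ^ (n - 1 - i) := by gcongr
          _ = r ^ (n - 1) := by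
            rw [← pow_add]
            congr 1
            have := Finset.mem_range.1 hi
            omega
    _ = _ := by simp

lemma charFun_stdGaussianReal (t : ℝ) :
    charFun (ProbabilityTheory.gaussianReal 0 1) t = (Real.exp (-t ^ 2 / 2) : ℝ) := by
  rw [ProbabilityTheory.charFun_gaussianReal]
  push_cast
  congr 1
  simp
  ring

/-- With `s = t / √n`, both the characteristic function at `s` and the Gaussian one are at most `exp
(-s² / 4)` in norm and differ by `O(β s³)`. Telescoping the difference of `n`-th powers multiplies
this by `n` and keeps `n - 1` Gaussian factors. -/
lemma norm_charFun_pow_sub_le {ν : Measure ℝ} [IsProbabilityMeasure ν]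
    (h3 : Integrable (fun v : ℝ => |v| ^ 3) ν) (h0 : ∫ v, v ∂ν = 0) (h2 : ∫ v, v ^ 2 ∂ν = 1)
    {n : ℕ} (hn : 1 ≤ n) {t : ℝ} (ht : 0 < t)
    (ht' : t ≤ Real.sqrt n / (16 * ∫ v, |v| ^ 3 ∂ν)) :
    ‖charFun ν (t / Real.sqrt n) ^ n - charFun (ProbabilityTheory.gaussianReal 0 1) t‖
      ≤ 10 * (∫ v, |v| ^ 3 ∂ν) / Real.sqrt n * t ^ 3 * Real.exp (-t ^ 2 / 4) := by
  set β := ∫ v, |v| ^ 3 ∂ν with hβ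
  have hβ1 : 1 ≤ β := one_le_integral_abs_pow_three h3 h2
  have hn0 : (0 : ℝ) < n := by exact_mod_cast hn
  have hsn : 0 < Real.sqrt n := Real.sqrt_pos.2 hn0
  have hsq : Real.sqrt n ^ 2 = n := Real.sq_sqrt hn0.le
  set s := t / Real.sqrt n with hs
  have hs0 : 0 < s := by positivity
  have hts : t = s * Real.sqrt n := by rw [hs]; field_simp
  have hs1 : 16 * β * s ≤ 1 := by
    rw [le_div_iff₀ (by positivity)] at ht'
    rw [hts] at ht'
    have : (16 * β * s) * Real.sqrt n ≤ 1 * Real.sqrt n := by linarith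
    exact le_of_mul_le_mul_right this hsn
  have hs16 : s ≤ 1 / 16 := by nlinarith
  have hφ := norm_charFun_sub_le h3 h0 h2 s
  rw [← hβ, abs_of_pos hs0] at hφ
  have hexp4 : 1 - s ^ 2 / 4 ≤ Real.exp (-s ^ 2 / 4) := by
    have := Real.add_one_le_exp (-s ^ 2 / 4)
    linarith
  have ha : ‖charFun ν s‖ ≤ Real.exp (-s ^ 2 / 4) := by
    have h1 : ‖((1 - s ^ 2 / 2 : ℝ) : ℂ)‖ = 1 - s ^ 2 / 2 := by
      rw [Complex.norm_real, Real.norm_of_nonneg]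
      nlinarith
    have h4 := norm_le_norm_add_norm_sub' (charFun ν s) ((1 - s ^ 2 / 2 : ℝ) : ℂ)
    rw [h1] at h4
    have : 4 * β * s ^ 3 ≤ s ^ 2 / 4 := by nlinarith [sq_nonneg s]
    linarith
  have hg : charFun (ProbabilityTheory.gaussianReal 0 1) t
      = ((Real.exp (-s ^ 2 / 2) : ℝ) : ℂ) ^ n := by
    rw [charFun_stdGaussianReal, ← Complex.ofReal_pow, ← Real.exp_nat_mul, hts, mul_pow, hsq]
    congr 2
    ring
  have hb : ‖((Real.exp (-s ^ 2 / 2) : ℝ) : ℂ)‖ ≤ Real.exp (-s ^ 2 / 4) := by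
    rw [Complex.norm_real, Real.norm_of_nonneg (Real.exp_pos _).le]
    exact Real.exp_le_exp.2 (by nlinarith [sq_nonneg s])
  have hab : ‖charFun ν s - ((Real.exp (-s ^ 2 / 2) : ℝ) : ℂ)‖ ≤ 5 * β * s ^ 3 := by
    have h5 : ‖((1 - s ^ 2 / 2 : ℝ) : ℂ) - ((Real.exp (-s ^ 2 / 2) : ℝ) : ℂ)‖ ≤ s ^ 3 := by
      rw [← Complex.ofReal_sub, Complex.norm_real, Real.norm_eq_abs]
      have h6 := Real.abs_exp_sub_one_sub_id_le (x := -s ^ 2 / 2)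
        (by rw [abs_le]; constructor <;> nlinarith)
      rw [abs_sub_comm]
      have h7 : Real.exp (-s ^ 2 / 2) - (1 - s ^ 2 / 2)
        = Real.exp (-s ^ 2 / 2) - 1 - (-s ^ 2 / 2) := by ring
      rw [h7]
      refine h6.trans ?_
      have : (-s ^ 2 / 2) ^ 2 = s ^ 3 * (s / 4) := by ring
      rw [this]
      have h8 : 0 < s ^ 3 := by positivity
      nlinarith
    have h9 := norm_sub_le_norm_sub_add_norm_sub (charFun ν s) ((1 - s ^ 2 / 2 : ℝ) : ℂ)
      ((Real.exp (-s ^ 2 / 2) : ℝ) : ℂ)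
    have : s ^ 3 ≤ β * s ^ 3 := le_mul_of_one_le_left (by positivity) hβ1
    linarith
  rw [hg]
  refine (norm_pow_sub_pow_le ha hb n).trans ?_
  -- The one missing factor costs `exp (s² / 4)`, which is below 2 because `s ≤ 1 / 16`.
  have hE : Real.exp (-s ^ 2 / 4) ^ (n - 1) ≤ 2 * Real.exp (-t ^ 2 / 4) := by
    rw [← Real.exp_nat_mul, hts, mul_pow, hsq, Nat.cast_sub hn]
    have : ((n : ℝ) - (1 : ℕ)) * (-s ^ 2 / 4) = s ^ 2 / 4 + -(s ^ 2 * n) / 4 := by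
      push_cast
      ring
    rw [this, Real.exp_add]
    gcongr
    have h10 : s ^ 2 / 4 ≤ 1 / 2 := by nlinarith
    refine (Real.exp_le_exp.2 h10).trans ?_
    have := Real.exp_bound_div_one_sub_of_interval (x := 1 / 2) (by norm_num) (by norm_num)
    norm_num at this ⊢
    exact this
  calc (n : ℝ) * Real.exp (-s ^ 2 / 4) ^ (n - 1)
        * ‖charFun ν s - ((Real.exp (-s ^ 2 / 2) : ℝ) : ℂ)‖
      ≤ n * (2 * Real.exp (-t ^ 2 / 4)) * (5 * β * s ^ 3) := by gcongr
    _ = 10 * β * (n * s ^ 3) * Real.exp (-t ^ 2 / 4) := by ring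
    _ = _ := by
        have : (n : ℝ) * s ^ 3 = t ^ 3 / Real.sqrt n := by
          rw [hts, mul_pow, eq_div_iff hsn.ne', ← hsq, Real.sqrt_sq hsn.le]
          ring
        rw [this]
        ring

/-! ### The Fejér kernel -/

/-- The Fejér kernel `∫₀¹ (1 - t) cos(tu) dt = (1 - cos u) / u²`. -/
def fejer (u : ℝ) : ℝ := ∫ t in (0 : ℝ)..1, (1 - t) * Real.cos (t * u)

/-- The primitive of the Fejér kernel that vanishes at `0`. -/
def fejerPrim (a : ℝ) : ℝ := ∫ t in (0 : ℝ)..1, (1 - t) * (a * Real.sinc (t * a))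

lemma fejer_eq {u : ℝ} (hu : u ≠ 0) : fejer u = (1 - Real.cos u) / u ^ 2 := by
  have h : ∀ t ∈ Set.uIcc (0 : ℝ) 1, HasDerivAt
      (fun t => (1 - t) * (Real.sin (t * u) / u) - Real.cos (t * u) / u ^ 2)
      ((1 - t) * Real.cos (t * u)) t := fun t _ => by
    have h1 : HasDerivAt (fun t : ℝ => t * u) u t := by
      simpa using (hasDerivAt_id t).mul_const u
    have h2 := ((((hasDerivAt_id t).const_sub 1).mul (h1.sin.div_const u)).sub
      (h1.cos.div_const (u ^ 2)))
    refine h2.congr_deriv ?_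
    simp only [id]
    field_simp
    ring
  rw [fejer, intervalIntegral.integral_eq_sub_of_hasDerivAt h
    (Continuous.intervalIntegrable (by fun_prop) _ _)]
  simp
  field_simp
  ring

lemma fejer_zero : fejer 0 = 1 / 2 := by
  have : ∫ t in (0 : ℝ)..1, (1 - t) = 1 / 2 := by
    rw [intervalIntegral.integral_sub (by simp) (by simp), integral_id]
    norm_num
  simpa [fejer] using this

lemma fejer_nonneg (u : ℝ) : 0 ≤ fejer u := by
  rcases eq_or_ne u 0 with rfl | hu
  · rw [fejer_zero]; norm_num
  · rw [fejer_eq hu]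
    exact div_nonneg (by linarith [Real.cos_le_one u]) (by positivity)

lemma continuous_fejer : Continuous fejer := by
  unfold fejer
  exact intervalIntegral.continuous_parametric_intervalIntegral_of_continuous' (by
    simp only [Function.uncurry_def]; fun_prop) _ _

lemma fejer_le (u : ℝ) : fejer u ≤ 4 * (1 + u ^ 2)⁻¹ := by
  rcases le_or_gt 1 (u ^ 2) with h | h
  · have hu : u ≠ 0 := by rintro rfl; norm_num at h
    rw [fejer_eq hu, ← div_eq_mul_inv, div_le_div_iff₀ (by positivity) (by positivity)]
    nlinarith [Real.neg_one_le_cos u, Real.cos_le_one u]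
  · have h1 : fejer u ≤ 1 := by
      have : fejer u ≤ ∫ _ in (0 : ℝ)..1, (1 : ℝ) := by
        refine intervalIntegral.integral_mono_on zero_le_one
          (Continuous.intervalIntegrable (by fun_prop) _ _) (by simp) fun t ht => ?_
        have h2 := Real.cos_le_one (t * u)
        have h3 := Real.neg_one_le_cos (t * u)
        nlinarith [ht.1, ht.2]
      simpa using this
    have h2 : 2⁻¹ ≤ (1 + u ^ 2)⁻¹ := by
      apply inv_anti₀ (by positivity)
      linarith
    linarith

lemma integrable_fejer : Integrable fejer := by
  refine (integrable_inv_one_add_sq.const_mul 4).mono'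
    continuous_fejer.aestronglyMeasurable (ae_of_all _ fun u => ?_)
  rw [Real.norm_of_nonneg (fejer_nonneg u)]
  exact fejer_le u

/-- The total mass of the Fejér kernel. -/
def fejerMass : ℝ := ∫ u, fejer u

lemma fejerMass_pos : 0 < fejerMass :=
  integral_pos_of_integrable_nonneg_nonzero (x := 0) continuous_fejer integrable_fejer
    fejer_nonneg (by rw [fejer_zero]; norm_num)

/-- Exchange the order of integration. The `sinc` form of `sin (t a) / t` has no singularity at `t =
0`, which keeps the later integrands continuous. -/
lemma integral_fejer (a : ℝ) : ∫ u in (0 : ℝ)..a, fejer u = fejerPrim a := by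
  have h1 : ∀ u, fejer u = ∫ t in Set.Ioc (0 : ℝ) 1, (1 - t) * Real.cos (t * u) := fun u =>
    intervalIntegral.integral_of_le zero_le_one
  simp_rw [h1]
  rw [intervalIntegral_integral_swap, fejerPrim, intervalIntegral.integral_of_le zero_le_one]
  · refine setIntegral_congr_fun measurableSet_Ioc fun t ht => ?_
    rw [intervalIntegral.integral_const_mul]
    congr 1
    have ht0 : t ≠ 0 := ht.1.ne'
    have h2 : ∫ u in (0 : ℝ)..a, Real.cos (t * u) = Real.sin (t * a) / t := by
      rw [intervalIntegral.integral_comp_mul_left (fun x => Real.cos x) ht0, integral_cos]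
      simp
      field_simp
    rw [h2]
    rcases eq_or_ne a 0 with rfl | ha
    · simp
    · rw [Real.sinc_of_ne_zero (mul_ne_zero ht0 ha)]
      field_simp
  · rw [Measure.prod_restrict]
    refine IntegrableOn.mono_set ?_
      (Set.prod_mono Set.uIoc_subset_uIcc (Set.Ioc_subset_Icc_self (a := (0 : ℝ)) (b := 1)))
    refine ContinuousOn.integrableOn_compact (isCompact_uIcc.prod isCompact_Icc) ?_
    apply Continuous.continuousOn
    simp only [Function.uncurry_def]
    fun_prop

/-- The probability measure whose density is proportional to the Fejér kernel. -/
def fejerMeasure : Measure ℝ := volume.withDensity fun u => ENNReal.ofReal (fejer u / fejerMass)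

lemma fejerMeasure_real_apply {s : Set ℝ} (hs : MeasurableSet s) :
    fejerMeasure.real s = ∫ u in s, fejer u / fejerMass := by
  rw [Measure.real, fejerMeasure, withDensity_apply _ hs,
    ← ofReal_integral_eq_lintegral_ofReal (integrable_fejer.div_const _).integrableOn
      (ae_of_all _ fun u => div_nonneg (fejer_nonneg u) fejerMass_pos.le),
    ENNReal.toReal_ofReal]
  exact integral_nonneg fun u => div_nonneg (fejer_nonneg u) fejerMass_pos.le

instance : IsProbabilityMeasure fejerMeasure where
  measure_univ := by
    rw [fejerMeasure, withDensity_apply _ MeasurableSet.univ, Measure.restrict_univ,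
      ← ofReal_integral_eq_lintegral_ofReal (integrable_fejer.div_const _)
      (ae_of_all _ fun u => div_nonneg (fejer_nonneg u) fejerMass_pos.le), integral_div]
    have : (∫ u, fejer u) / fejerMass = 1 := div_self fejerMass_pos.ne'
    rw [this, ENNReal.ofReal_one]

lemma fejerMeasure_real_Iio (a : ℝ) :
    fejerMeasure.real (Set.Iio a) = fejerMeasure.real (Set.Iio 0) + fejerPrim a / fejerMass := by
  have hi := fun b : ℝ => (integrable_fejer.div_const fejerMass).integrableOn (s := Set.Iic b)
  have h := intervalIntegral.integral_Iic_sub_Iic (hi 0) (hi a)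
  rw [intervalIntegral.integral_div, integral_fejer] at h
  rw [fejerMeasure_real_apply measurableSet_Iio, fejerMeasure_real_apply measurableSet_Iio,
    ← integral_Iic_eq_integral_Iio, ← integral_Iic_eq_integral_Iio]
  linarith

lemma exists_fejerMeasure_compl_le :
    ∃ h : ℝ, 0 < h ∧ fejerMeasure.real {u | h < |u|} ≤ 1 / 8 := by
  have h := tendsto_measure_iInter_atTop (μ := fejerMeasure)
    (s := fun h : ℝ => {u : ℝ | h < |u|})
    (fun s => (measurableSet_lt measurable_const (by fun_prop)).nullMeasurableSet)
    (fun a b hab u hu => lt_of_le_of_lt hab hu) ⟨0, measure_ne_top _ _⟩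
  have h2 : (⋂ s : ℝ, {u : ℝ | s < |u|}) = ∅ := by
    ext x
    simp only [Set.mem_iInter, Set.mem_ofPred_eq, Set.mem_empty_iff_false, iff_false, not_forall]
    exact ⟨|x|, lt_irrefl _⟩
  rw [h2, measure_empty] at h
  have h3 := (ENNReal.tendsto_toReal ENNReal.zero_ne_top).comp h
  rw [ENNReal.toReal_zero] at h3
  obtain ⟨s, hs, hs'⟩ := ((h3.eventually (gt_mem_nhds (show (0 : ℝ) < 1 / 8 by norm_num))).and
    (eventually_gt_atTop (0 : ℝ))).exists
  exact ⟨s, hs', hs.le⟩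

/-! ### Esseen's smoothing inequality -/

lemma integral_measureReal_swap {α β : Type*} [MeasurableSpace α] [MeasurableSpace β]
    {μ : Measure α} {κ : Measure β} [IsProbabilityMeasure μ] [IsProbabilityMeasure κ]
    {s : Set (α × β)} (hs : MeasurableSet s) :
    ∫ w, κ.real {u | (w, u) ∈ s} ∂μ = ∫ u, μ.real {w | (w, u) ∈ s} ∂κ := by
  have h1 : ∫ w, κ.real {u | (w, u) ∈ s} ∂μ = ((μ.prod κ) s).toReal := by
    rw [Measure.prod_apply hs]
    exact integral_toReal (measurable_measure_prodMk_left hs).aemeasurable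
      (ae_of_all _ fun w => measure_lt_top _ _)
  have h2 : ∫ u, μ.real {w | (w, u) ∈ s} ∂κ = ((μ.prod κ) s).toReal := by
    rw [Measure.prod_apply_symm hs]
    exact integral_toReal (measurable_measure_prodMk_right hs).aemeasurable
      (ae_of_all _ fun w => measure_lt_top _ _)
  rw [h1, h2]

lemma integrable_fejerMeasure_real_Iio {μ : Measure ℝ} [IsProbabilityMeasure μ] (x T : ℝ) :
    Integrable (fun w => fejerMeasure.real (Set.Iio (T * (w - x)))) μ := by
  refine (integrable_const (1 : ℝ)).mono' ?_ (ae_of_all _ fun w => ?_)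
  · have hs : MeasurableSet {p : ℝ × ℝ | p.2 < T * (p.1 - x)} :=
      measurableSet_lt (by fun_prop) (by fun_prop)
    exact (measurable_measure_prodMk_left (ν := fejerMeasure)
      hs).ennreal_toReal.aestronglyMeasurable
  · rw [Real.norm_of_nonneg measureReal_nonneg]
    exact measureReal_le_one

/-- By Fubini, smoothing the tail of `μ` at scale `1 / T` amounts to integrating the distribution
function of the kernel against `μ`. The additive constant cancels when two laws are compared. -/
lemma integral_fejerPrim {μ : Measure ℝ} [IsProbabilityMeasure μ] (x : ℝ) {T : ℝ} (hT : 0 < T) :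
    ∫ u, μ.real (Set.Ioi (x + u / T)) ∂fejerMeasure
      = fejerMeasure.real (Set.Iio 0) + (∫ w, fejerPrim (T * (w - x)) ∂μ) / fejerMass := by
  have hs : MeasurableSet {p : ℝ × ℝ | p.2 < T * (p.1 - x)} :=
    measurableSet_lt (by fun_prop) (by fun_prop)
  have h := integral_measureReal_swap (μ := μ) (κ := fejerMeasure) hs
  have h1 : ∀ u, {w : ℝ | (w, u) ∈ {p : ℝ × ℝ | p.2 < T * (p.1 - x)}}
      = Set.Ioi (x + u / T) := fun u => by
    ext w
    simp only [Set.mem_ofPred_eq, Set.mem_Ioi]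
    rw [← lt_sub_iff_add_lt', div_lt_iff₀ hT, mul_comm]
  simp_rw [h1] at h
  rw [← h]
  have h2 : ∀ w, fejerPrim (T * (w - x)) / fejerMass
      = fejerMeasure.real (Set.Iio (T * (w - x))) - fejerMeasure.real (Set.Iio 0) := fun w => by
    rw [fejerMeasure_real_Iio (T * (w - x))]
    ring
  rw [← integral_div]
  simp_rw [h2]
  rw [integral_sub (integrable_fejerMeasure_real_Iio x T) (integrable_const _)]
  simp only [integral_const, probReal_univ, smul_eq_mul, one_mul, add_sub_cancel]
  rfl

lemma integral_fejerPrim_eq {μ : Measure ℝ} [IsProbabilityMeasure μ]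
    (hμ : Integrable (fun w : ℝ => w) μ) (x T : ℝ) :
    ∫ w, fejerPrim (T * (w - x)) ∂μ = ∫ t in (0 : ℝ)..1, ∫ w,
      (1 - t) * (T * (w - x) * Real.sinc (t * (T * (w - x)))) ∂μ := by
  rw [intervalIntegral_integral_swap]
  · rfl
  · rw [Set.uIoc_of_le zero_le_one]
    have hd : Integrable (fun p : ℝ × ℝ => |T * (p.2 - x)|)
        ((volume.restrict (Set.Ioc (0 : ℝ) 1)).prod μ) := by
      have h1 : Integrable (fun w : ℝ => |T * (w - x)|) μ :=
        ((hμ.sub (integrable_const x)).const_mul T).abs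
      exact h1.comp_snd _
    refine hd.mono' ?_ ?_
    · apply Continuous.aestronglyMeasurable
      have := Real.continuous_sinc
      simp only [Function.uncurry_def]
      fun_prop
    · have h2 : ∀ᵐ p ∂((volume.restrict (Set.Ioc (0 : ℝ) 1)).prod μ), p.1 ∈ Set.Ioc (0 : ℝ) 1 := by
        have := ae_restrict_mem (μ := (volume : Measure ℝ)) (measurableSet_Ioc (a := (0 : ℝ)) (b := 1))
        exact (Measure.quasiMeasurePreserving_fst).ae this
      filter_upwards [h2] with p hp
      simp only [Function.uncurry_def, norm_mul, Real.norm_eq_abs]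
      have h3 : |1 - p.1| ≤ 1 := by rw [abs_le]; constructor <;> linarith [hp.1, hp.2]
      have h4 := Real.abs_sinc_le_one (p.1 * (T * (p.2 - x)))
      rw [abs_mul]
      calc |1 - p.1| * (|T| * |p.2 - x| * |Real.sinc (p.1 * (T * (p.2 - x)))|)
          ≤ 1 * (|T| * |p.2 - x| * 1) := by gcongr
        _ = _ := by ring

/-- The integrand is `sin (t T (w - x)) / t`, the imaginary part of a complex exponential over `t`.
Since `t` ranges over `(0, 1]`, the smoothed tail sees the characteristic function only on `(0, T]`;
this is the reason for a kernel with compactly supported Fourier transform. -/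
lemma integral_mul_sinc_eq {μ : Measure ℝ} [IsProbabilityMeasure μ] (x T : ℝ) {t : ℝ}
    (ht : t ≠ 0) :
    ∫ w, T * (w - x) * Real.sinc (t * (T * (w - x))) ∂μ
      = (Complex.exp (-(t * T * x : ℝ) * Complex.I) * charFun μ (t * T)).im / t := by
  have h1 : ∀ w : ℝ, T * (w - x) * Real.sinc (t * (T * (w - x)))
      = RCLike.im (Complex.exp (-(t * T * x : ℝ) * Complex.I)
        * Complex.exp ((t * T : ℝ) * w * Complex.I)) / t := fun w => by
    rw [← Complex.exp_add]
    have h2 : -(t * T * x : ℝ) * Complex.I + (t * T : ℝ) * w * Complex.I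
        = ((t * (T * (w - x)) : ℝ) : ℂ) * Complex.I := by
      push_cast
      ring
    rw [h2]
    have h3 : RCLike.im (Complex.exp (((t * (T * (w - x)) : ℝ) : ℂ) * Complex.I))
        = Real.sin (t * (T * (w - x))) := Complex.exp_ofReal_mul_I_im _
    rw [h3]
    rcases eq_or_ne (T * (w - x)) 0 with h0 | h0
    · rw [h0]; simp
    · rw [Real.sinc_of_ne_zero (mul_ne_zero ht h0)]
      generalize T * (w - x) = y at h0
      field_simp
  simp_rw [h1]
  have hint : Integrable (fun w : ℝ => Complex.exp (-(t * T * x : ℝ) * Complex.I)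
        * Complex.exp ((t * T : ℝ) * w * Complex.I)) μ := by
    refine Integrable.const_mul ((integrable_const (1 : ℝ)).mono' (by fun_prop)
      (ae_of_all _ fun w => ?_)) _
    rw [← Complex.ofReal_mul, Complex.norm_exp_ofReal_mul_I]
  rw [integral_div, integral_im hint, integral_const_mul, charFun_apply_real]
  rfl

lemma integral_div_one_add_sq_le (T : ℝ) :
    ∫ t in (0 : ℝ)..1, 32 * (T * (1 + (t * T) ^ 2)⁻¹) ≤ 64 := by
  have h : ∀ t ∈ Set.uIcc (0 : ℝ) 1, HasDerivAt (fun t => 32 * Real.arctan (t * T))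
      (32 * (T * (1 + (t * T) ^ 2)⁻¹)) t := fun t _ => by
    have h1 : HasDerivAt (fun t : ℝ => t * T) T t := by
      simpa using (hasDerivAt_id t).mul_const T
    refine (h1.arctan.const_mul 32).congr_deriv ?_
    simp
    ring
  have hc : Continuous fun t : ℝ => 32 * (T * (1 + (t * T) ^ 2)⁻¹) := by
    refine continuous_const.mul (continuous_const.mul (Continuous.inv₀ (by fun_prop) fun t => ?_))
    positivity
  rw [intervalIntegral.integral_eq_sub_of_hasDerivAt h (hc.intervalIntegrable _ _)]
  simp
  linarith [Real.arctan_lt_pi_div_two T, Real.pi_lt_four]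

/-- Replaces the Gaussian weight by a derivative of the arctangent, whose integral is explicit and
bounded uniformly in `T`. -/
lemma sq_mul_exp_le (y : ℝ) : y ^ 2 * Real.exp (-y ^ 2 / 4) ≤ 32 * (1 + y ^ 2)⁻¹ := by
  have h1 : 1 + y ^ 2 / 4 + (y ^ 2 / 4) ^ 2 / 2 ≤ Real.exp (y ^ 2 / 4) :=
    Real.quadratic_le_exp_of_nonneg (by positivity)
  have h2 : -y ^ 2 / 4 = -(y ^ 2 / 4) := by ring
  rw [h2, Real.exp_neg, ← div_eq_mul_inv, ← div_eq_mul_inv,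
    div_le_div_iff₀ (Real.exp_pos _) (by positivity)]
  nlinarith [sq_nonneg y, sq_nonneg (y ^ 2)]

lemma abs_integral_fejerPrim_sub_le {μ γ : Measure ℝ} [IsProbabilityMeasure μ]
    [IsProbabilityMeasure γ] (hμ : Integrable (fun w : ℝ => w) μ)
    (hγ : Integrable (fun w : ℝ => w) γ) (x : ℝ) {T B : ℝ} (hT : 0 < T) (hB : 0 ≤ B)
    (h : ∀ t, 0 < t → t ≤ T →
      ‖charFun μ t - charFun γ t‖ ≤ B * t ^ 3 * Real.exp (-t ^ 2 / 4)) :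
    |∫ w, fejerPrim (T * (w - x)) ∂μ - ∫ w, fejerPrim (T * (w - x)) ∂γ| ≤ 64 * B := by
  have hii : ∀ (ρ : Measure ℝ) [IsProbabilityMeasure ρ], Integrable (fun w : ℝ => w) ρ →
      IntervalIntegrable (fun t : ℝ => ∫ w,
        (1 - t) * (T * (w - x) * Real.sinc (t * (T * (w - x)))) ∂ρ) volume 0 1 := by
    intro ρ _ hρ
    refine Continuous.intervalIntegrable ?_ _ _
    simp_rw [integral_const_mul]
    refine (by fun_prop : Continuous fun t : ℝ => 1 - t).mul ?_
    refine continuous_of_dominated (bound := fun w => |T * (w - x)|)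
      (fun t => Continuous.aestronglyMeasurable ?_) (fun t => ae_of_all _ fun w => ?_)
      ((hρ.sub (integrable_const x)).const_mul T).abs (ae_of_all _ fun w => ?_)
    · have := Real.continuous_sinc
      fun_prop
    · rw [norm_mul, Real.norm_eq_abs, Real.norm_eq_abs]
      exact mul_le_of_le_one_right (abs_nonneg _) (Real.abs_sinc_le_one _)
    · have := Real.continuous_sinc
      fun_prop
  rw [integral_fejerPrim_eq hμ, integral_fejerPrim_eq hγ,
    ← intervalIntegral.integral_sub (hii μ hμ) (hii γ hγ), ← Real.norm_eq_abs]
  have hc : Continuous fun t : ℝ => B * (32 * (T * (1 + (t * T) ^ 2)⁻¹)) := by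
    refine continuous_const.mul (continuous_const.mul (continuous_const.mul
      (Continuous.inv₀ (by fun_prop) fun t => ?_)))
    positivity
  refine (intervalIntegral.norm_integral_le_of_norm_le
    (g := fun t => B * (32 * (T * (1 + (t * T) ^ 2)⁻¹))) zero_le_one
    (ae_of_all _ fun t ht => ?_) (hc.intervalIntegrable _ _)).trans ?_
  · have ht0 : 0 < t := ht.1
    rw [integral_const_mul, integral_const_mul, integral_mul_sinc_eq x T ht0.ne',
      integral_mul_sinc_eq x T ht0.ne', ← mul_sub, ← sub_div, ← Complex.sub_im, ← mul_sub,
      norm_mul, norm_div, Real.norm_eq_abs, Real.norm_eq_abs, Real.norm_eq_abs, abs_of_pos ht0]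
    have h1 : |1 - t| ≤ 1 := by rw [abs_le]; constructor <;> linarith [ht.1, ht.2]
    have h2 := Complex.abs_im_le_norm (Complex.exp (-(t * T * x : ℝ) * Complex.I)
      * (charFun μ (t * T) - charFun γ (t * T)))
    have h3 : ‖Complex.exp (-(t * T * x : ℝ) * Complex.I)‖ = 1 := by
      rw [← Complex.ofReal_neg, Complex.norm_exp_ofReal_mul_I]
    rw [norm_mul, h3, one_mul] at h2
    have h4 := h (t * T) (by positivity) (mul_le_of_le_one_left hT.le ht.2)
    have h5 := sq_mul_exp_le (t * T)
    calc _ ≤ 1 * ((B * (t * T) ^ 3 * Real.exp (-(t * T) ^ 2 / 4)) / t) := by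
          gcongr
          exact h2.trans h4
      _ = B * T * ((t * T) ^ 2 * Real.exp (-(t * T) ^ 2 / 4)) := by
          field_simp
      _ ≤ B * T * (32 * (1 + (t * T) ^ 2)⁻¹) := by gcongr
      _ = _ := by ring
  · rw [intervalIntegral.integral_const_mul, mul_comm]
    gcongr
    exact integral_div_one_add_sq_le T

/-- A discrepancy `c` between the tails at one point persists, up to `2 |h| / T`, on an interval of
length `2 h / T` to one side when `h ≥ 0`, because one tail is monotone and the other Lipschitz.
Centring the kernel on that interval makes the smoothed discrepancy see it with mass at least `7 /
8`. -/
lemma smoothing_desmoothing {μ γ κ : Measure ℝ} [IsProbabilityMeasure μ] [IsProbabilityMeasure γ]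
    [IsProbabilityMeasure κ] {h E T : ℝ} (hT : 0 < T)
    (hκ : κ.real {u | h < |u|} ≤ 1 / 8)
    (hγ : ∀ s t, s ≤ t → γ.real (Set.Ioi s) - γ.real (Set.Ioi t) ≤ t - s)
    (hE : ∀ x, |∫ u, μ.real (Set.Ioi (x + u / T)) ∂κ - ∫ u, γ.real (Set.Ioi (x + u / T)) ∂κ| ≤ E)
    (x : ℝ) :
    |μ.real (Set.Ioi x) - γ.real (Set.Ioi x)| ≤ 4 / 3 * (E + 2 * |h| / T) := by
  set Δ : ℝ → ℝ := fun x => μ.real (Set.Ioi x) - γ.real (Set.Ioi x) with hΔ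
  have hle : ∀ (ρ : Measure ℝ) [IsProbabilityMeasure ρ] y, ρ.real (Set.Ioi y) ≤ 1 :=
    fun ρ _ y => measureReal_le_one
  have hnn : ∀ (ρ : Measure ℝ) y, 0 ≤ ρ.real (Set.Ioi y) := fun ρ y => measureReal_nonneg
  have hanti : ∀ (ρ : Measure ℝ) [IsProbabilityMeasure ρ], Antitone fun y => ρ.real (Set.Ioi y) :=
    fun ρ _ a b hab => measureReal_mono (Set.Ioi_subset_Ioi hab)
  have hΔ1 : ∀ y, |Δ y| ≤ 1 := fun y => by
    rw [abs_le]
    constructor <;> simp only [hΔ] <;> linarith [hle μ y, hle γ y, hnn μ y, hnn γ y]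
  have hbdd : BddAbove (Set.range fun y => |Δ y|) := ⟨1, by rintro _ ⟨y, rfl⟩; exact hΔ1 y⟩
  set D := ⨆ y, |Δ y| with hD
  have hΔD : ∀ y, |Δ y| ≤ D := fun y => le_ciSup hbdd y
  have hD0 : 0 ≤ D := (abs_nonneg _).trans (hΔD 0)
  have hint : ∀ (ρ : Measure ℝ) [IsProbabilityMeasure ρ] x,
      Integrable (fun u => ρ.real (Set.Ioi (x + u / T))) κ := fun ρ _ x => by
    refine (integrable_const (1 : ℝ)).mono' ?_ (ae_of_all _ fun u => ?_)
    · exact ((hanti ρ).measurable.comp (by fun_prop)).aestronglyMeasurable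
    · rw [Real.norm_of_nonneg (hnn _ _)]
      exact hle ρ _
  have hintΔ : ∀ x, Integrable (fun u => Δ (x + u / T)) κ := fun x => (hint μ x).sub (hint γ x)
  have hEΔ : ∀ x, |∫ u, Δ (x + u / T) ∂κ| ≤ E := fun x => by
    have := hE x
    rwa [← integral_sub (hint μ x) (hint γ x)] at this
  have hE0 : 0 ≤ E := (abs_nonneg _).trans (hEΔ 0)
  set p := κ.real {u | h < |u|} with hp
  have hp0 : 0 ≤ p := measureReal_nonneg
  have hms : MeasurableSet {u : ℝ | h < |u|} := measurableSet_lt measurable_const (by fun_prop)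
  have hind : Integrable (Set.indicator {u : ℝ | h < |u|} fun _ => (1 : ℝ)) κ :=
    (integrable_const _).indicator hms
  have hindint : ∫ u, Set.indicator {u : ℝ | h < |u|} (fun _ => (1 : ℝ)) u ∂κ = p := by
    rw [integral_indicator_const _ hms]
    simp [hp]
  have hη : 0 ≤ 2 * |h| / T := by positivity
  -- Outside `|u| ≤ h` the integrand is only known to be at least `-D`, on mass at most `1 / 8`.
  -- This gives `7 c / 8 ≤ E + 2 |h| / T + D / 8`; taking the supremum over `c` and solving for `D`
  -- yields the factor `4 / 3`.
  have key : ∀ (f : ℝ → ℝ) (c : ℝ), Integrable f κ → 0 ≤ c → (∀ u, -D ≤ f u) →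
      (∀ u, |u| ≤ h → c - 2 * |h| / T ≤ f u) → ∫ u, f u ∂κ ≤ E →
      c ≤ 8 / 7 * (E + 2 * |h| / T) + D / 7 := by
    intro f c hf hc h1 h2 h3
    have h4 : ∫ u, ((c - 2 * |h| / T)
        - (c + D) * Set.indicator {u : ℝ | h < |u|} (fun _ => (1 : ℝ)) u) ∂κ ≤ ∫ u, f u ∂κ := by
      refine integral_mono ((integrable_const _).sub (hind.const_mul _)) hf fun u => ?_
      simp only [Set.indicator_apply, Set.mem_ofPred_eq]
      split_ifs with hu
      · linarith [h1 u]
      · linarith [h2 u (not_lt.1 hu)]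
    rw [integral_sub (integrable_const _) (hind.const_mul _), integral_const_mul, hindint] at h4
    simp only [integral_const, probReal_univ, smul_eq_mul, one_mul] at h4
    nlinarith
  have hshift : ∀ y, |Δ y| ≤ 8 / 7 * (E + 2 * |h| / T) + D / 7 := by
    intro y
    have hu1 : ∀ u : ℝ, |u| ≤ h → |u / T| ≤ |h| / T := fun u hu => by
      rw [abs_div, abs_of_pos hT]
      exact div_le_div_of_nonneg_right (hu.trans (le_abs_self h)) hT.le
    have hη2 : 2 * |h| / T = |h| / T + |h| / T := by ring
    rcases le_total 0 (Δ y) with hy | hy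
    · rw [abs_of_nonneg hy]
      refine key (fun u => Δ (y - |h| / T + u / T)) _ (hintΔ _) hy
        (fun u => (abs_le.1 (hΔD _)).1) (fun u hu => ?_) ((le_abs_self _).trans (hEΔ _))
      have h5 := abs_le.1 (hu1 u hu)
      have h6 : y - |h| / T + u / T ≤ y := by linarith
      have h7 := hanti μ h6
      have h8 := hγ _ _ h6
      simp only [hΔ] at h7 ⊢
      linarith
    · rw [abs_of_nonpos hy]
      refine key (fun u => -Δ (y + |h| / T + u / T)) _ (hintΔ _).neg (by linarith)
        (fun u => neg_le_neg (abs_le.1 (hΔD _)).2) (fun u hu => ?_) ?_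
      · have h5 := abs_le.1 (hu1 u hu)
        have h6 : y ≤ y + |h| / T + u / T := by linarith
        have h7 := hanti μ h6
        have h8 := hγ _ _ h6
        simp only [hΔ] at h7 ⊢
        linarith
      · rw [integral_neg]
        exact (neg_le_abs _).trans (hEΔ _)
  have hDle : D ≤ 8 / 7 * (E + 2 * |h| / T) + D / 7 := ciSup_le hshift
  have := hΔD x
  simp only [hΔ] at this
  linarith

/-- A form of **Esseen's smoothing inequality**. -/
lemma exists_smoothing_const : ∃ A : ℝ, 0 < A ∧ ∀ (μ : Measure ℝ) [IsProbabilityMeasure μ],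
    Integrable (fun w : ℝ => w) μ → ∀ T B : ℝ, 0 < T → 0 ≤ B →
    (∀ t, 0 < t → t ≤ T → ‖charFun μ t - charFun (ProbabilityTheory.gaussianReal 0 1) t‖
      ≤ B * t ^ 3 * Real.exp (-t ^ 2 / 4)) →
    ∀ x, |μ.real (Set.Ioi x) - gaussQ x| ≤ A * (B + 1 / T) := by
  obtain ⟨h, hh, hκ⟩ := exists_fejerMeasure_compl_le
  have hm := fejerMass_pos
  refine ⟨4 / 3 * (64 / fejerMass + 2 * h), by positivity, fun μ _ hμ T B hT hB hφ x => ?_⟩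
  have hγ : Integrable (fun w : ℝ => w) (ProbabilityTheory.gaussianReal 0 1) :=
    (ProbabilityTheory.memLp_id_gaussianReal 1).integrable (by simp)
  have := smoothing_desmoothing (μ := μ) (γ := ProbabilityTheory.gaussianReal 0 1)
    (κ := fejerMeasure) (h := h) (E := 64 * B / fejerMass) hT hκ
    (fun s t hst => by
      rw [← gaussQ_eq_gaussianReal, ← gaussQ_eq_gaussianReal]; exact gaussQ_sub_le hst)
    (fun y => by
      rw [integral_fejerPrim y hT, integral_fejerPrim y hT, add_sub_add_left_eq_sub, ← sub_div,
        abs_div, abs_of_pos hm]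
      gcongr
      exact abs_integral_fejerPrim_sub_le hμ hγ y hT hB hφ) x
  rw [gaussQ_eq_gaussianReal]
  refine this.trans ?_
  rw [abs_of_pos hh]
  have h1 : 0 ≤ 1 / T := by positivity
  have h2 : 0 ≤ 64 / fejerMass := by positivity
  have h3 : 64 * B / fejerMass = 64 / fejerMass * B := by ring
  have h4 : 2 * h / T = 2 * h * (1 / T) := by ring
  rw [h3, h4, mul_assoc (4 / 3 : ℝ) (64 / fejerMass + 2 * h)]
  refine mul_le_mul_of_nonneg_left ?_ (show (0 : ℝ) ≤ 4 / 3 by norm_num)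
  nlinarith [mul_nonneg h2 h1, mul_nonneg hh.le hB]

/-! ### The Berry-Esseen theorem -/

lemma isBerryEsseenConst_of_unit_variance {K : ℝ}
    (hK : ∀ ν : Measure ℝ, IsProbabilityMeasure ν →
      Integrable (fun v : ℝ => |v| ^ 3) ν → ∫ v, v ∂ν = 0 → ∫ v, v ^ 2 ∂ν = 1 →
      ∀ n : ℕ, 1 ≤ n → ∀ t : ℝ,
        |(Measure.pi (fun _ : Fin n => ν)).real {v | t * Real.sqrt n < ∑ i, v i} - gaussQ t|
          ≤ K * (∫ u, |u| ^ 3 ∂ν) / Real.sqrt n) :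
    IsBerryEsseenConst K := by
  intro ν _ h3 h0 h2 n hn t
  set σ := Real.sqrt (∫ u, u ^ 2 ∂ν) with hσ
  have hσ0 : 0 < σ := Real.sqrt_pos.2 h2
  have hσ2 : σ ^ 2 = ∫ u, u ^ 2 ∂ν := Real.sq_sqrt h2.le
  have hmeas : Measurable fun v : ℝ => v / σ := by fun_prop
  have hemb : ∀ f : ℝ → ℝ, Measurable f →
      ∫ v, f v ∂(ν.map fun v => v / σ) = ∫ v, f (v / σ) ∂ν := fun f hf =>
    integral_map hmeas.aemeasurable hf.aestronglyMeasurable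
  have hcube : (fun v : ℝ => |v / σ| ^ 3) = fun v => |v| ^ 3 / σ ^ 3 := by
    funext v
    rw [abs_div, abs_of_pos hσ0, div_pow]
  have hprob : IsProbabilityMeasure (ν.map fun v => v / σ) :=
    Measure.isProbabilityMeasure_map hmeas.aemeasurable
  have := hK (ν.map fun v => v / σ) hprob
    (by
      rw [integrable_map_measure (by fun_prop) hmeas.aemeasurable]
      have : Integrable (fun v : ℝ => |v / σ| ^ 3) ν := by
        rw [hcube]; exact h3.div_const _
      exact this)
    (by rw [hemb (fun v => v) (by fun_prop), integral_div, h0, zero_div])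
    (by
      rw [hemb (fun v => v ^ 2) (by fun_prop)]
      simp_rw [div_pow]
      rw [integral_div, hσ2, div_self h2.ne']) n hn t
  rw [hemb (fun v => |v| ^ 3) (by fun_prop), hcube, integral_div] at this
  have hpi : Measure.pi (fun _ : Fin n => ν.map fun v => v / σ)
      = (Measure.pi (fun _ : Fin n => ν)).map (fun v i => v i / σ) :=
    (Measure.pi_map_pi (fun _ => hmeas.aemeasurable)).symm
  rw [hpi, map_measureReal_apply (by fun_prop)
    (measurableSet_lt measurable_const (by fun_prop))] at this
  have hset : (fun (v : Fin n → ℝ) i => v i / σ) ⁻¹' {v | t * Real.sqrt n < ∑ i, v i}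
      = {v | t * (Real.sqrt n * σ) < ∑ i, v i} := by
    ext v
    simp only [Set.mem_preimage, Set.mem_ofPred_eq]
    rw [← Finset.sum_div, lt_div_iff₀ hσ0, mul_assoc]
  rw [hset] at this
  refine this.trans (le_of_eq ?_)
  field_simp

/-- The **Berry-Esseen theorem**, with an unspecified constant. -/
theorem exists_isBerryEsseenConst : ∃ K, IsBerryEsseenConst K := by
  obtain ⟨A, hA, hS⟩ := exists_smoothing_const
  -- `26 = 10 + 16`: the smoothing bound is used with `B = 10 β / √n` and `1 / T = 16 β / √n`.
  refine ⟨26 * A, isBerryEsseenConst_of_unit_variance fun ν _ h3 h0 h2 n hn t => ?_⟩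
  set β := ∫ v, |v| ^ 3 ∂ν with hβ
  have hβ1 : 1 ≤ β := one_le_integral_abs_pow_three h3 h2
  have hn0 : (0 : ℝ) < n := by exact_mod_cast hn
  have hsn : 0 < Real.sqrt n := Real.sqrt_pos.2 hn0
  have hmeas : Measurable fun v : Fin n → ℝ => (Real.sqrt n)⁻¹ * ∑ i, v i := by fun_prop
  set μ := (Measure.pi (fun _ : Fin n => ν)).map fun v => (Real.sqrt n)⁻¹ * ∑ i, v i with hμdef
  have hprob : IsProbabilityMeasure μ := Measure.isProbabilityMeasure_map hmeas.aemeasurable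
  have hμ : Integrable (fun w : ℝ => w) μ := by
    rw [hμdef, integrable_map_measure (by fun_prop) hmeas.aemeasurable]
    have : Integrable (fun v : Fin n → ℝ => (Real.sqrt n)⁻¹ * ∑ i, v i)
        (Measure.pi (fun _ : Fin n => ν)) := by
      refine Integrable.const_mul (integrable_finsetSum _ fun i _ => ?_) _
      exact integrable_comp_eval (μ := fun _ : Fin n => ν) (i := i)
        (integrable_id_of_integrable_abs_pow_three h3)
    exact this
  have hchar : ∀ s, charFun μ s = charFun ν (s / Real.sqrt n) ^ n := fun s => by
    rw [hμdef, charFun_map_mul_comp (by fun_prop), ProbabilityTheory.charFun_map_sum_pi_eq_prod]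
    simp
    congr 2
    ring
  have := hS μ hμ (Real.sqrt n / (16 * β)) (10 * β / Real.sqrt n) (by positivity) (by positivity)
    (fun s hs hs' => by
      rw [hchar]
      exact norm_charFun_pow_sub_le h3 h0 h2 hn hs hs') t
  have hset : (fun v : Fin n → ℝ => (Real.sqrt n)⁻¹ * ∑ i, v i) ⁻¹' Set.Ioi t
      = {v | t * Real.sqrt n < ∑ i, v i} := by
    ext v
    simp only [Set.mem_preimage, Set.mem_ofPred_eq, Set.mem_Ioi]
    rw [lt_inv_mul_iff₀ hsn, mul_comm]
  rw [hμdef, map_measureReal_apply hmeas measurableSet_Ioi, hset] at this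
  refine this.trans (le_of_eq ?_)
  field_simp
  ring

lemma isBerryEsseenConst_of_le {K K' : ℝ} (h : IsBerryEsseenConst K) (hK : K ≤ K') :
    IsBerryEsseenConst K' := fun ν hν h3 h0 h2 n hn t => by
  refine (h ν hν h3 h0 h2 n hn t).trans ?_
  gcongr

/-- The centred two point law witnessing that a Berry-Esseen constant is positive. -/
lemma pos_of_isBerryEsseenConst {K : ℝ} (h : IsBerryEsseenConst K) : gaussQ 1 ≤ K := by
  set ν : Measure ℝ := (2 : ℝ≥0∞)⁻¹ • (Measure.dirac 1 + Measure.dirac (-1)) with hν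
  have hprob : IsProbabilityMeasure ν := ⟨by
    simp only [hν, Measure.smul_apply, Measure.add_apply, measure_univ, smul_eq_mul]
    rw [one_add_one_eq_two, ENNReal.inv_mul_cancel (by simp) (by simp)]⟩
  have hi : ∀ f : ℝ → ℝ, Integrable f ν := fun f =>
    ((integrable_dirac (by simp)).add_measure (integrable_dirac (by simp))).smul_measure (by simp)
  have he : ∀ f : ℝ → ℝ, ∫ v, f v ∂ν = (f 1 + f (-1)) / 2 := fun f => by
    rw [hν, integral_smul_measure, integral_add_measure (integrable_dirac (by simp))
      (integrable_dirac (by simp)), integral_dirac, integral_dirac]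
    simp
    ring
  -- One fair sign never exceeds `t = 1`, so the deviation is exactly `gaussQ 1`, while the moment
  -- ratio is 1.
  have := h ν hprob (hi _) (by rw [he]; norm_num) (by rw [he]; norm_num) 1 le_rfl 1
  rw [he, he] at this
  norm_num at this
  have hz : (Measure.pi (fun _ : Fin 1 => ν)).real {v | 1 < v 0} = 0 := by
    have hp : {v : Fin 1 → ℝ | 1 < v 0} = (fun v => v 0) ⁻¹' Set.Ioi 1 := rfl
    have hmp := measurePreserving_eval (fun _ : Fin 1 => ν) 0
    rw [hp, Measure.real, hmp.measure_preimage measurableSet_Ioi.nullMeasurableSet]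
    simp [hν]
  rw [hz, zero_sub, abs_neg, abs_of_pos (gaussQ_pos 1)] at this
  exact this

/-- The optimal constant is admissible, and so is every larger one. -/
theorem isBerryEsseenConst_of_berryEsseenConst_le {C : ℝ} (hC : berryEsseenConst ≤ C) :
    IsBerryEsseenConst C := by
  refine isBerryEsseenConst_of_le ?_ hC
  intro ν hν h3 h0 h2 n hn t
  have hne : {K : ℝ | IsBerryEsseenConst K}.Nonempty := exists_isBerryEsseenConst
  have hσ : 0 < Real.sqrt (∫ u, u ^ 2 ∂ν) := Real.sqrt_pos.2 h2
  have hn0 : 0 < Real.sqrt n := Real.sqrt_pos.2 (by exact_mod_cast hn)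
  refine ge_of_tendsto (f := fun K => K * (∫ u, |u| ^ 3 ∂ν)
      / (Real.sqrt n * Real.sqrt (∫ u, u ^ 2 ∂ν) ^ 3)) (x := 𝓝[>] berryEsseenConst) ?_ ?_
  · refine (Continuous.tendsto (by fun_prop) _).mono_left nhdsWithin_le_nhds
  · filter_upwards [self_mem_nhdsWithin] with K hK
    obtain ⟨K', hK', hlt⟩ := exists_lt_of_csInf_lt hne hK
    exact isBerryEsseenConst_of_le hK' hlt.le ν hν h3 h0 h2 n hn t

/-! ### The random linear code -/

section Codes

variable {m n : ℕ}

lemma mem_codewords {H : Matrix (Fin m) (Fin n) (ZMod 2)} {x : Fin n → ZMod 2} :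
    x ∈ codewords H ↔ H *ᵥ x = 0 ∧ x ≠ 0 := by
  simp [codewords]

lemma codewords_nonempty (hmn : m < n) (H : Matrix (Fin m) (Fin n) (ZMod 2)) :
    (codewords H).Nonempty := by
  have h := LinearMap.ker_ne_bot_of_finrank_lt (f := H.mulVecLin) (by simpa using hmn)
  obtain ⟨x, hx, hx0⟩ := Submodule.exists_mem_ne_zero_of_ne_bot h
  exact ⟨x, mem_codewords.2 ⟨by simpa using hx, hx0⟩⟩

/-- The syndrome map `H ↦ H *ᵥ x` is a surjective homomorphism when `x ≠ 0`, so all its fibres have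
equal size. -/
lemma card_filter_mulVec_eq_zero {x : Fin n → ZMod 2} (hx : x ≠ 0) :
    (Finset.univ.filter fun H : Matrix (Fin m) (Fin n) (ZMod 2) => H *ᵥ x = 0).card * 2 ^ m
      = Fintype.card (Matrix (Fin m) (Fin n) (ZMod 2)) := by
  classical
  let φ : Matrix (Fin m) (Fin n) (ZMod 2) →+ (Fin m → ZMod 2) :=
    { toFun := fun H => H *ᵥ x
      map_zero' := Matrix.zero_mulVec x
      map_add' := fun A B => Matrix.add_mulVec A B x }
  obtain ⟨j, hj⟩ := Function.ne_iff.1 hx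
  have hj1 : x j = 1 := by
    have : ∀ a : ZMod 2, a ≠ 0 → a = 1 := by decide
    exact this _ hj
  have hsurj : Function.Surjective φ := fun c =>
    ⟨Matrix.of fun i l => if l = j then c i else 0, by
      funext i
      simp [φ, Matrix.mulVec, dotProduct, hj1]⟩
  have h1 : Fintype.card (Matrix (Fin m) (Fin n) (ZMod 2))
      = ∑ c : Fin m → ZMod 2, (Finset.univ.filter fun H => φ H = c).card := by
    rw [← Finset.card_univ]
    exact Finset.card_eq_sum_card_fiberwise fun _ _ => Finset.mem_coe.2 (Finset.mem_univ _)
  have h2 : ∀ c, (Finset.univ.filter fun H => φ H = c).card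
      = (Finset.univ.filter fun H => φ H = 0).card := fun c =>
    AddMonoidHom.card_fiber_eq_of_mem_range φ (hsurj c) (hsurj 0)
  rw [h1, Finset.sum_congr rfl fun c _ => h2 c, Finset.sum_const, Finset.card_univ, smul_eq_mul,
    mul_comm]
  congr 1
  simp [ZMod.card]

/-- Over `ZMod 2` the only unit is 1, so nonzero vectors are the same as projective points, on which
the linear group acts 2-transitively. -/
lemma exists_linearEquiv_apply_eq {x x' z z' : Fin n → ZMod 2} (hx : x ≠ 0) (hx' : x' ≠ 0)
    (hxx : x ≠ x') (hz : z ≠ 0) (hz' : z' ≠ 0) (hzz : z ≠ z') :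
    ∃ e : (Fin n → ZMod 2) ≃ₗ[ZMod 2] (Fin n → ZMod 2), e x = z ∧ e x' = z' := by
  have hu : ∀ a : (ZMod 2)ˣ, a = 1 := by decide
  have hmk : ∀ {v w : Fin n → ZMod 2} (hv : v ≠ 0) (hw : w ≠ 0),
      Projectivization.mk (ZMod 2) v hv = Projectivization.mk (ZMod 2) w hw → v = w := by
    intro v w hv hw h
    obtain ⟨a, ha⟩ := (Projectivization.mk_eq_mk_iff (ZMod 2) v w hv hw).1 h
    rw [hu a, one_smul] at ha
    exact ha.symm
  have hne : Projectivization.mk (ZMod 2) x hx ≠ Projectivization.mk (ZMod 2) x' hx' :=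
    fun h => hxx (hmk _ _ h)
  have hne' : Projectivization.mk (ZMod 2) z hz ≠ Projectivization.mk (ZMod 2) z' hz' :=
    fun h => hzz (hmk _ _ h)
  obtain ⟨g, hg, hg'⟩ := (MulAction.is_two_pretransitive_iff).1
    (Projectivization.linearEquiv_is_two_pretransitive (ZMod 2) (Fin n → ZMod 2)) hne hne'
  rw [Projectivization.smul_mk] at hg hg'
  exact ⟨g, hmk _ _ hg, hmk _ _ hg'⟩

/-- Right multiplication by an invertible matrix, as a permutation of the parity check matrices. -/
def mulRightEquiv (e : (Fin n → ZMod 2) ≃ₗ[ZMod 2] (Fin n → ZMod 2)) :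
    Matrix (Fin m) (Fin n) (ZMod 2) ≃ Matrix (Fin m) (Fin n) (ZMod 2) where
  toFun H := H * LinearMap.toMatrix' (e : (Fin n → ZMod 2) →ₗ[ZMod 2] (Fin n → ZMod 2))
  invFun H := H * LinearMap.toMatrix' (e.symm : (Fin n → ZMod 2) →ₗ[ZMod 2] (Fin n → ZMod 2))
  left_inv H := by
    simp only [Matrix.mul_assoc, ← LinearMap.toMatrix'_comp]
    simp
  right_inv H := by
    simp only [Matrix.mul_assoc, ← LinearMap.toMatrix'_comp]
    simp

lemma mem_codewords_mulRightEquiv (e : (Fin n → ZMod 2) ≃ₗ[ZMod 2] (Fin n → ZMod 2))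
    (H : Matrix (Fin m) (Fin n) (ZMod 2)) (x : Fin n → ZMod 2) :
    x ∈ codewords (mulRightEquiv e H) ↔ e x ∈ codewords H := by
  rw [mem_codewords, mem_codewords, mulRightEquiv, Equiv.coe_fn_mk, ← Matrix.mulVec_mulVec,
    LinearMap.toMatrix'_mulVec]
  simp

lemma card_codewords_mulRightEquiv (e : (Fin n → ZMod 2) ≃ₗ[ZMod 2] (Fin n → ZMod 2))
    (H : Matrix (Fin m) (Fin n) (ZMod 2)) :
    (codewords (mulRightEquiv e H)).card = (codewords H).card := by
  refine Finset.card_bij (fun x _ => e x)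
    (fun x hx => (mem_codewords_mulRightEquiv e H x).1 hx) (fun x _ y _ h => e.injective h)
    fun y hy => ⟨e.symm y, ?_, by simp⟩
  rw [mem_codewords_mulRightEquiv]
  simpa using hy

variable (m) in
/-- The number of parity check matrices times the joint probability that `x` is sent and `x'` is a
codeword. -/
def pairWeight (x x' : Fin n → ZMod 2) : ℝ :=
  ∑ H : Matrix (Fin m) (Fin n) (ZMod 2),
    if x ∈ codewords H ∧ x' ∈ codewords H then ((codewords H).card : ℝ)⁻¹ else 0

/-- The uniform law on parity check matrices is invariant under right multiplication by an
invertible matrix, which transports codewords and preserves their number. -/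
lemma pairWeight_apply (e : (Fin n → ZMod 2) ≃ₗ[ZMod 2] (Fin n → ZMod 2))
    (x x' : Fin n → ZMod 2) : pairWeight m (e x) (e x') = pairWeight m x x' := by
  rw [pairWeight, pairWeight, ← Equiv.sum_comp (mulRightEquiv e) fun H =>
    if x ∈ codewords H ∧ x' ∈ codewords H then ((codewords H).card : ℝ)⁻¹ else 0]
  simp only [card_codewords_mulRightEquiv, mem_codewords_mulRightEquiv]

lemma pairWeight_self_eq {x z : Fin n → ZMod 2} (hx : x ≠ 0) (hz : z ≠ 0) :
    pairWeight m x x = pairWeight m z z := by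
  rcases eq_or_ne x z with rfl | h
  · rfl
  · obtain ⟨e, he, -⟩ := exists_linearEquiv_apply_eq hx hz h hz hx h.symm
    rw [← he, pairWeight_apply]

lemma pairWeight_eq {x x' z z' : Fin n → ZMod 2} (hx : x ≠ 0) (hx' : x' ≠ 0)
    (hxx : x ≠ x') (hz : z ≠ 0) (hz' : z' ≠ 0) (hzz : z ≠ z') :
    pairWeight m x x' = pairWeight m z z' := by
  obtain ⟨e, he, he'⟩ := exists_linearEquiv_apply_eq hx hx' hxx hz hz' hzz
  rw [← he, ← he', pairWeight_apply]

lemma codewords_eq_filter (H : Matrix (Fin m) (Fin n) (ZMod 2)) :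
    codewords H = (Finset.univ.filter fun x : Fin n → ZMod 2 => x ≠ 0).filter
      fun x => x ∈ codewords H := by
  ext x
  simp only [Finset.mem_filter, Finset.mem_univ, true_and]
  exact ⟨fun h => ⟨(mem_codewords.1 h).2, h⟩, fun h => h.2⟩

lemma sum_codewords_div_eq (f : (Fin n → ZMod 2) → ℝ) :
    ∑ H : Matrix (Fin m) (Fin n) (ZMod 2), ((codewords H).card : ℝ)⁻¹ * ∑ x ∈ codewords H, f x
      = ∑ x with x ≠ 0, pairWeight m x x * f x := by
  simp_rw [pairWeight, Finset.sum_mul]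
  rw [Finset.sum_comm]
  refine Finset.sum_congr rfl fun H _ => ?_
  conv_lhs => rw [codewords_eq_filter H, Finset.sum_filter, ← codewords_eq_filter H]
  rw [Finset.mul_sum]
  refine Finset.sum_congr rfl fun x _ => ?_
  by_cases h : x ∈ codewords H <;> simp [h]

lemma sum_codewords_pair_div_eq (f : (Fin n → ZMod 2) → (Fin n → ZMod 2) → ℝ) :
    ∑ H : Matrix (Fin m) (Fin n) (ZMod 2), ((codewords H).card : ℝ)⁻¹ *
        ∑ x ∈ codewords H, ∑ x' ∈ (codewords H).erase x, f x x'
      = ∑ x with x ≠ 0, ∑ x' ∈ (Finset.univ.filter fun x' : Fin n → ZMod 2 => x' ≠ 0).erase x,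
          pairWeight m x x' * f x x' := by
  simp_rw [pairWeight, Finset.sum_mul]
  have h1 : ∀ x : Fin n → ZMod 2,
      ∑ x' ∈ (Finset.univ.filter fun x' : Fin n → ZMod 2 => x' ≠ 0).erase x,
        ∑ H : Matrix (Fin m) (Fin n) (ZMod 2),
          (if x ∈ codewords H ∧ x' ∈ codewords H then ((codewords H).card : ℝ)⁻¹ else 0) * f x x'
      = ∑ H : Matrix (Fin m) (Fin n) (ZMod 2),
        ∑ x' ∈ (Finset.univ.filter fun x' : Fin n → ZMod 2 => x' ≠ 0).erase x,
          (if x ∈ codewords H ∧ x' ∈ codewords H then ((codewords H).card : ℝ)⁻¹ else 0) * f x x' :=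
    fun x => Finset.sum_comm
  simp_rw [h1]
  rw [Finset.sum_comm]
  refine Finset.sum_congr rfl fun H _ => ?_
  conv_lhs => rw [codewords_eq_filter H, Finset.sum_filter, ← codewords_eq_filter H]
  rw [Finset.mul_sum]
  refine Finset.sum_congr rfl fun x _ => ?_
  by_cases h : x ∈ codewords H
  · have h2 : (codewords H).erase x
        = ((Finset.univ.filter fun x' : Fin n → ZMod 2 => x' ≠ 0).erase x).filter
          fun x' => x' ∈ codewords H := by
      ext x'
      simp only [Finset.mem_erase, Finset.mem_filter, Finset.mem_univ, true_and]
      exact ⟨fun h => ⟨⟨h.1, (mem_codewords.1 h.2).2⟩, h.2⟩, fun h => ⟨h.1.1, h.2⟩⟩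
    simp only [h, true_and, if_true]
    rw [h2, Finset.sum_filter, Finset.mul_sum]
    refine Finset.sum_congr rfl fun x' _ => ?_
    by_cases h' : x' ∈ codewords H <;> simp [h']
  · simp [h]

lemma card_filter_ne_zero :
    ((Finset.univ.filter fun x : Fin n → ZMod 2 => x ≠ 0).card : ℝ) = 2 ^ n - 1 := by
  rw [Finset.filter_ne' Finset.univ (0 : Fin n → ZMod 2),
    Finset.card_erase_of_mem (Finset.mem_univ _), Finset.card_univ]
  have : 1 ≤ 2 ^ n := Nat.one_le_two_pow
  simp [ZMod.card, Nat.cast_sub this]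

/-- By symmetry the sent word is uniform on nonzero vectors. Summing over `x`, each matrix
contributes 1, since `m < n` guarantees a nonzero codeword. -/
lemma pairWeight_self_mul (hmn : m < n) {x : Fin n → ZMod 2} (hx : x ≠ 0) :
    pairWeight m x x * (2 ^ n - 1) = Fintype.card (Matrix (Fin m) (Fin n) (ZMod 2)) := by
  have h := sum_codewords_div_eq (m := m) (n := n) fun _ => 1
  have h1 : ∀ H : Matrix (Fin m) (Fin n) (ZMod 2),
      ((codewords H).card : ℝ)⁻¹ * ∑ x ∈ codewords H, (1 : ℝ) = 1 := fun H => by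
    have : ((codewords H).card : ℝ) ≠ 0 := by
      exact_mod_cast (Finset.card_pos.2 (codewords_nonempty hmn H)).ne'
    simp [this]
  rw [Finset.sum_congr rfl fun H _ => h1 H, Finset.sum_congr rfl fun z hz =>
    show pairWeight m z z * 1 = pairWeight m x x by
      rw [mul_one, pairWeight_self_eq (Finset.mem_filter.1 hz).2 hx]] at h
  simp only [Finset.sum_const, Finset.card_univ, nsmul_eq_mul, mul_one, card_filter_ne_zero] at h
  rw [mul_comm, ← h]

lemma sum_card_codewords :
    ∑ H : Matrix (Fin m) (Fin n) (ZMod 2), ((codewords H).card : ℝ)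
      = (2 ^ n - 1) * (Fintype.card (Matrix (Fin m) (Fin n) (ZMod 2)) / 2 ^ m) := by
  have h1 : ∀ H : Matrix (Fin m) (Fin n) (ZMod 2), ((codewords H).card : ℝ)
      = ∑ x : Fin n → ZMod 2 with x ≠ 0, if H *ᵥ x = 0 then 1 else 0 := fun H => by
    rw [Finset.sum_boole, Finset.filter_filter]
    congr 2
    ext x
    simp [mem_codewords, and_comm]
  simp_rw [h1]
  rw [Finset.sum_comm, Finset.sum_congr rfl fun x hx => show _ =
    ((Fintype.card (Matrix (Fin m) (Fin n) (ZMod 2)) / 2 ^ m : ℝ)) by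
      rw [Finset.sum_boole, eq_div_iff (by positivity)]
      exact_mod_cast card_filter_mulVec_eq_zero (m := m) (Finset.mem_filter.1 hx).2,
    Finset.sum_const, nsmul_eq_mul, card_filter_ne_zero]

/-- Summed over all ordered pairs, a code with `K` codewords contributes `K (K - 1) / K = K - 1`.
The random normalization cancels, and only the mean number of codewords is needed. -/
lemma pairWeight_mul (hmn : m < n) {x x' : Fin n → ZMod 2} (hx : x ≠ 0) (hx' : x' ≠ 0)
    (hxx : x ≠ x') :
    pairWeight m x x' * ((2 ^ n - 1) * (2 ^ n - 2))
      = Fintype.card (Matrix (Fin m) (Fin n) (ZMod 2)) * ((2 ^ n - 1) / 2 ^ m - 1) := by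
  have h := sum_codewords_pair_div_eq (m := m) (n := n) fun _ _ => 1
  have h1 : ∀ H : Matrix (Fin m) (Fin n) (ZMod 2), ((codewords H).card : ℝ)⁻¹ *
      ∑ x ∈ codewords H, ∑ x' ∈ (codewords H).erase x, (1 : ℝ)
        = ((codewords H).card : ℝ) - 1 := fun H => by
    have hc := Finset.card_pos.2 (codewords_nonempty hmn H)
    have : ((codewords H).card : ℝ) ≠ 0 := by exact_mod_cast hc.ne'
    rw [Finset.sum_congr rfl fun x hx => show
      ∑ x' ∈ (codewords H).erase x, (1 : ℝ) = ((codewords H).card : ℝ) - 1 by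
        rw [Finset.sum_const, nsmul_eq_mul, mul_one, Finset.card_erase_of_mem hx,
          Nat.cast_sub hc, Nat.cast_one], Finset.sum_const, nsmul_eq_mul, inv_mul_cancel_left₀ this]
  have h2 : ∀ z ∈ Finset.univ.filter (fun x : Fin n → ZMod 2 => x ≠ 0),
      ∑ z' ∈ (Finset.univ.filter fun x : Fin n → ZMod 2 => x ≠ 0).erase z,
        pairWeight m z z' * 1 = (2 ^ n - 2) * pairWeight m x x' := fun z hz => by
    have hz0 := (Finset.mem_filter.1 hz).2
    rw [Finset.sum_congr rfl fun z' hz' => show pairWeight m z z' * 1 = pairWeight m x x' by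
      have := Finset.mem_erase.1 hz'
      rw [mul_one, pairWeight_eq hz0 (Finset.mem_filter.1 this.2).2 this.1.symm hx hx' hxx],
      Finset.sum_const, nsmul_eq_mul, Finset.card_erase_of_mem hz,
      Nat.cast_sub (Finset.card_pos.2 ⟨z, hz⟩), card_filter_ne_zero]
    push_cast
    ring
  rw [Finset.sum_congr rfl fun H _ => h1 H, Finset.sum_sub_distrib, sum_card_codewords,
    Finset.sum_congr rfl h2] at h
  simp only [Finset.sum_const, Finset.card_univ, nsmul_eq_mul, mul_one, card_filter_ne_zero] at h
  linear_combination -h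

lemma pairWeight_le (hm : 1 ≤ m) (hmn : m < n) {x x' : Fin n → ZMod 2} (hx : x ≠ 0)
    (hx' : x' ≠ 0) (hxx : x ≠ x') :
    pairWeight m x x' ≤ Fintype.card (Matrix (Fin m) (Fin n) (ZMod 2)) / (2 ^ m * 2 ^ n) := by
  have h := pairWeight_mul hmn hx hx' hxx
  have hM : (2 : ℝ) ≤ 2 ^ m := by
    calc (2 : ℝ) = 2 ^ 1 := by norm_num
      _ ≤ 2 ^ m := pow_le_pow_right₀ one_le_two hm
  have hN : (4 : ℝ) ≤ 2 ^ n := by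
    calc (4 : ℝ) = 2 ^ 2 := by norm_num
      _ ≤ 2 ^ n := pow_le_pow_right₀ one_le_two (by omega)
  set N : ℝ := 2 ^ n
  set M : ℝ := 2 ^ m
  set c : ℝ := (Fintype.card (Matrix (Fin m) (Fin n) (ZMod 2)) : ℝ)
  have hc : 0 ≤ c := Nat.cast_nonneg _
  have hpos : 0 < (N - 1) * (N - 2) := mul_pos (by linarith) (by linarith)
  rw [← mul_le_mul_iff_left₀ hpos, h]
  have : c / (M * N) * ((N - 1) * (N - 2)) - c * ((N - 1) / M - 1)
      = c * ((M * N - 2 * (N - 1)) / (M * N)) := by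
    field_simp
    ring
  have h3 : 0 ≤ c * ((M * N - 2 * (N - 1)) / (M * N)) :=
    mul_nonneg hc (div_nonneg (by nlinarith) (by positivity))
  linarith

/-- The union bound, averaged over a random linear code: `a x` bounds the probability that the sent
word `x` is not in the list, `b x x'` the probability that `x` and `x'` are both in the list. -/
lemma average_error_le (hm : 1 ≤ m) (hmn : m < n) {a : (Fin n → ZMod 2) → ℝ}
    {b : (Fin n → ZMod 2) → (Fin n → ZMod 2) → ℝ} {L : ℝ} (hL : 1 ≤ L)
    (ha : ∀ x, 0 ≤ a x) (ha1 : ∀ x, a x ≤ 1) (hb : ∀ x x', 0 ≤ b x x')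
    (hab : ∀ x, ∑ x' ∈ Finset.univ.erase x, b x x' ≤ (L - 1) * (1 - a x))
    {err : Matrix (Fin m) (Fin n) (ZMod 2) → (Fin n → ZMod 2) → ℝ}
    (herr : ∀ H, ∀ x ∈ codewords H, err H x ≤ a x + ∑ x' ∈ (codewords H).erase x, b x x') :
    (Fintype.card (Matrix (Fin m) (Fin n) (ZMod 2)) : ℝ)⁻¹ *
        ∑ H : Matrix (Fin m) (Fin n) (ZMod 2), ((codewords H).card : ℝ)⁻¹ *
          ∑ x ∈ codewords H, err H x
      ≤ (2 ^ n : ℝ)⁻¹ * ∑ x, a x + (2 ^ m : ℝ)⁻¹ * L := by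
  have hM : (2 : ℝ) ≤ 2 ^ m := by
    calc (2 : ℝ) = 2 ^ 1 := by norm_num
      _ ≤ 2 ^ m := pow_le_pow_right₀ one_le_two hm
  have hMN : (2 : ℝ) * 2 ^ m ≤ 2 ^ n := by
    calc (2 : ℝ) * 2 ^ m = 2 ^ (m + 1) := by ring
      _ ≤ 2 ^ n := pow_le_pow_right₀ one_le_two hmn
  have hcard : (Fintype.card (Fin n → ZMod 2) : ℝ) = 2 ^ n := by simp [ZMod.card]
  have hw1 : ∀ x : Fin n → ZMod 2, x ≠ 0 → pairWeight m x x
      = Fintype.card (Matrix (Fin m) (Fin n) (ZMod 2)) / (2 ^ n - 1) := fun x hx => by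
    rw [eq_div_iff (by linarith), pairWeight_self_mul hmn hx]
  have hw2 := fun x x' : Fin n → ZMod 2 => pairWeight_le (m := m) (n := n) hm hmn (x := x) (x' := x')
  set N : ℝ := 2 ^ n
  set M : ℝ := 2 ^ m
  have hc : (0 : ℝ) < Fintype.card (Matrix (Fin m) (Fin n) (ZMod 2)) := by
    exact_mod_cast Fintype.card_pos
  set c : ℝ := (Fintype.card (Matrix (Fin m) (Fin n) (ZMod 2)) : ℝ)
  set S := ∑ x, a x with hS
  have hSN : S ≤ N := by
    calc S ≤ ∑ _x : Fin n → ZMod 2, (1 : ℝ) := Finset.sum_le_sum fun x _ => ha1 x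
      _ = N := by simp [← hcard]
  have hS0 : 0 ≤ S := Finset.sum_nonneg fun x _ => ha x
  have h1 : ∑ H : Matrix (Fin m) (Fin n) (ZMod 2), ((codewords H).card : ℝ)⁻¹ *
        ∑ x ∈ codewords H, err H x
      ≤ c / (N - 1) * S + c / (M * N) * ((L - 1) * (N - S)) := by
    calc _ ≤ ∑ H : Matrix (Fin m) (Fin n) (ZMod 2), ((codewords H).card : ℝ)⁻¹ *
          ∑ x ∈ codewords H, (a x + ∑ x' ∈ (codewords H).erase x, b x x') := by
          refine Finset.sum_le_sum fun H _ => mul_le_mul_of_nonneg_left ?_ (by positivity)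
          exact Finset.sum_le_sum fun x hx => herr H x hx
      _ = ∑ x with x ≠ 0, pairWeight m x x * a x + ∑ x with x ≠ 0,
          ∑ x' ∈ (Finset.univ.filter fun x' : Fin n → ZMod 2 => x' ≠ 0).erase x,
            pairWeight m x x' * b x x' := by
          rw [← sum_codewords_div_eq, ← sum_codewords_pair_div_eq, ← Finset.sum_add_distrib]
          refine Finset.sum_congr rfl fun H _ => ?_
          rw [← mul_add, Finset.sum_add_distrib]
      _ ≤ c / (N - 1) * S + c / (M * N) * ((L - 1) * (N - S)) := by
          have hN1 : 0 ≤ c / (N - 1) := div_nonneg hc.le (by linarith)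
          have hMN0 : 0 ≤ c / (M * N) := by positivity
          refine add_le_add ?_ ?_
          · rw [hS, Finset.mul_sum]
            calc _ = ∑ x with x ≠ 0, c / (N - 1) * a x :=
                  Finset.sum_congr rfl fun x hx => by rw [hw1 x (Finset.mem_filter.1 hx).2]
              _ ≤ _ := Finset.sum_le_sum_of_subset_of_nonneg (Finset.subset_univ _)
                  fun x _ _ => mul_nonneg hN1 (ha x)
          · calc _ ≤ ∑ x : Fin n → ZMod 2 with x ≠ 0,
                    c / (M * N) * ((L - 1) * (1 - a x)) := by
                  refine Finset.sum_le_sum fun x hx => ?_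
                  have hx0 := (Finset.mem_filter.1 hx).2
                  refine le_trans ?_ (mul_le_mul_of_nonneg_left (hab x) hMN0)
                  rw [Finset.mul_sum]
                  refine (Finset.sum_le_sum fun x' hx' => ?_).trans
                    (Finset.sum_le_sum_of_subset_of_nonneg
                      (Finset.erase_subset_erase x (Finset.subset_univ _))
                      fun x' _ _ => mul_nonneg hMN0 (hb x x'))
                  have hx'' := Finset.mem_erase.1 hx'
                  exact mul_le_mul_of_nonneg_right
                    (hw2 x x' hx0 (Finset.mem_filter.1 hx''.2).2 hx''.1.symm) (hb x x')
              _ ≤ ∑ x : Fin n → ZMod 2, c / (M * N) * ((L - 1) * (1 - a x)) :=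
                  Finset.sum_le_sum_of_subset_of_nonneg (Finset.subset_univ _) fun x _ _ =>
                    mul_nonneg hMN0 (mul_nonneg (by linarith) (by linarith [ha1 x]))
              _ = _ := by
                  rw [← Finset.mul_sum, ← Finset.mul_sum, Finset.sum_sub_distrib]
                  simp [← hcard, hS]
  rw [inv_mul_le_iff₀ hc]
  refine h1.trans ?_
  have hN : 0 < N := by linarith
  have hN1 : 0 < N - 1 := by linarith
  have hM0 : 0 < M := by linarith
  have e1 : c / (N - 1) * S + c / (M * N) * ((L - 1) * (N - S))
      = c * (S / N + S / (N * (N - 1)) + (L - 1) * (N - S) / (M * N)) := by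
    field_simp
    ring
  rw [e1]
  refine mul_le_mul_of_nonneg_left ?_ hc.le
  -- Puncturing the zero word inflates the first term from `S / N` to `S / (N - 1)`. Since `M ≤ N -
  -- 1`, the excess is at most `S / (M * N)`, which fits into the room left in the second term by
  -- the factor `1 - a x` and by `L - 1` in place of `L`.
  have e2 : S / (N * (N - 1)) ≤ S / (M * N) :=
    div_le_div_of_nonneg_left hS0 (by positivity) (by nlinarith)
  have e3 : S / (M * N) + (L - 1) * (N - S) / (M * N) ≤ M⁻¹ * L := by
    rw [← add_div, div_le_iff₀ (by positivity)]
    have : M⁻¹ * L * (M * N) = L * N := by field_simp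
    rw [this]
    nlinarith
  have e4 : S / N = N⁻¹ * S := by ring
  linarith

end Codes

/-! ### The joint law of a channel -/

namespace BIMC

variable {Y : Type*} [MeasurableSpace Y] (W : BIMC Y)

lemma joint_apply {s : Set (ZMod 2 × Y)} (hs : MeasurableSet s) :
    W.joint s = (2 : ℝ≥0∞)⁻¹ * ∑ x : ZMod 2, W.out x {y | (x, y) ∈ s} := by
  rw [joint, Measure.smul_apply, smul_eq_mul, Measure.finsetSum_apply]
  congr 1
  refine Finset.sum_congr rfl fun x _ => ?_
  rw [Measure.map_apply measurable_prodMk_left hs]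
  rfl

instance : IsProbabilityMeasure W.joint where
  measure_univ := by
    rw [W.joint_apply MeasurableSet.univ]
    simp only [Set.mem_univ, Set.ofPred_true, measure_univ, Finset.sum_const, Finset.card_univ,
      ZMod.card, nsmul_eq_mul, mul_one]
    exact ENNReal.inv_mul_cancel (by simp) (by simp)

/-- The i.i.d. law of the pairs is the uniform mixture, over input blocks, of the channel output
laws. This identifies the average miss probability with a tail of an i.i.d. sum. -/
lemma pi_joint {n : ℕ} :
    Measure.pi (fun _ : Fin n => W.joint) = ((2 : ℝ≥0∞)⁻¹ ^ n) •
      ∑ x : Fin n → ZMod 2, (W.outBlock x).map fun y i => (x i, y i) := by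
  refine Measure.pi_eq fun s hs => ?_
  rw [Measure.smul_apply, Measure.finsetSum_apply, smul_eq_mul]
  have h1 : ∀ x : Fin n → ZMod 2, (W.outBlock x).map (fun y i => (x i, y i)) (Set.univ.pi s)
      = ∏ i, W.out (x i) {y | (x i, y) ∈ s i} := fun x => by
    rw [Measure.map_apply (by fun_prop) (MeasurableSet.univ_pi hs), outBlock]
    have : (fun (y : Fin n → Y) i => (x i, y i)) ⁻¹' Set.univ.pi s
        = Set.univ.pi fun i => {y | (x i, y) ∈ s i} := by
      ext y
      simp [Set.mem_pi]
    rw [this, Measure.pi_pi]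
  simp_rw [h1, fun i => W.joint_apply (hs i)]
  rw [Finset.prod_mul_distrib, Finset.prod_const, Finset.card_univ, Fintype.card_fin,
    Finset.prod_univ_sum, Fintype.piFinset_univ]

lemma measurable_post : Measurable fun z : ZMod 2 × Y => W.post z.1 z.2 := by
  refine measurable_from_prod_countable_right fun x => ?_
  have h := W.measurable_dens
  exact (h x).coe_nnreal_real.div ((h 0).coe_nnreal_real.add (h 1).coe_nnreal_real)

lemma measurable_info : Measurable W.info :=
  (Real.measurable_log.comp W.measurable_post).neg

lemma post_nonneg (x : ZMod 2) (y : Y) : 0 ≤ W.post x y := by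
  unfold post
  positivity

/-- Equality holds unless both densities vanish at `y`, where division by zero makes the sum 0. -/
lemma sum_post_le_one (y : Y) : ∑ x, W.post x y ≤ 1 := by
  have : ∑ x, W.post x y = (W.dens 0 y + W.dens 1 y : ℝ) / (W.dens 0 y + W.dens 1 y) := by
    rw [add_div]
    exact Fin.sum_univ_two (fun x : Fin 2 => W.post x y)
  rw [this]
  exact div_self_le_one _

lemma post_le_one (x : ZMod 2) (y : Y) : W.post x y ≤ 1 :=
  (Finset.single_le_sum (f := fun x => W.post x y) (fun x _ => W.post_nonneg x y)
    (Finset.mem_univ x)).trans (W.sum_post_le_one y)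

lemma info_nonneg (z : ZMod 2 × Y) : 0 ≤ W.info z :=
  neg_nonneg.2 (Real.log_nonpos (W.post_nonneg _ _) (W.post_le_one _ _))

lemma ae_dens_pos (x : ZMod 2) : ∀ᵐ y ∂(W.out x), 0 < W.dens x y := by
  rw [out, ae_withDensity_iff (by have := W.measurable_dens x; fun_prop)]
  refine ae_of_all _ fun y hy => ?_
  rw [ne_eq, ENNReal.coe_eq_zero] at hy
  exact pos_iff_ne_zero.2 hy

lemma post_pos {x : ZMod 2} {y : Y} (h : 0 < W.dens x y) : 0 < W.post x y := by
  have hs : (W.dens x y : ℝ) ≤ W.dens 0 y + W.dens 1 y := by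
    have : ∀ x : ZMod 2, x = 0 ∨ x = 1 := by decide
    rcases this x with rfl | rfl
    · exact le_add_of_nonneg_right (NNReal.coe_nonneg _)
    · exact le_add_of_nonneg_left (NNReal.coe_nonneg _)
  have h' : (0 : ℝ) < W.dens x y := by exact_mod_cast h
  exact div_pos h' (h'.trans_le hs)

lemma ae_post_pos : ∀ᵐ z ∂W.joint, 0 < W.post z.1 z.2 := by
  have hs : MeasurableSet {z : ZMod 2 × Y | ¬0 < W.post z.1 z.2} :=
    (measurableSet_lt measurable_const W.measurable_post).compl
  rw [ae_iff, W.joint_apply hs]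
  simp only [mul_eq_zero, Finset.sum_eq_zero_iff, Finset.mem_univ, true_imp_iff]
  refine Or.inr fun x => ?_
  have := W.ae_dens_pos x
  exact (ae_iff.1 (this.mono fun y hy => W.post_pos hy))

/-! ### Jars -/

lemma prod_dens_div {n : ℕ} (x : Fin n → ZMod 2) (y : Fin n → Y) :
    (∏ i, (W.dens (x i) (y i) : ℝ)) / ∏ i, ((W.dens 0 (y i) : ℝ) + (W.dens 1 (y i) : ℝ))
      = ∏ i, W.post (x i) (y i) := by
  rw [← Finset.prod_div_distrib]
  rfl

lemma mem_jar_iff {n : ℕ} (hn : 1 ≤ n) {d : ℝ} {x : Fin n → ZMod 2} {y : Fin n → Y} :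
    x ∈ W.jar d y ↔ 0 < ∏ i, W.post (x i) (y i) ∧
      Real.exp (-(n * (W.condEntropy + d))) ≤ ∏ i, W.post (x i) (y i) := by
  have hn0 : (0 : ℝ) < n := by exact_mod_cast hn
  rw [jar, Set.mem_ofPred_eq, prod_dens_div]
  refine and_congr_right fun h => ?_
  rw [← Real.le_log_iff_exp_le h,
    show -(1 / (n : ℝ)) * Real.log (∏ i, W.post (x i) (y i))
      = (-Real.log (∏ i, W.post (x i) (y i))) / n by ring, div_le_iff₀ hn0, neg_le, mul_comm]

lemma sum_prod_post_le_one {n : ℕ} (y : Fin n → Y) :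
    ∑ x : Fin n → ZMod 2, ∏ i, W.post (x i) (y i) ≤ 1 := by
  have h : ∏ i, ∑ b, W.post b (y i) = ∑ x : Fin n → ZMod 2, ∏ i, W.post (x i) (y i) := by
    rw [Finset.prod_univ_sum, Fintype.piFinset_univ]
  rw [← h]
  exact Finset.prod_le_one (fun i _ => Finset.sum_nonneg fun b _ => W.post_nonneg b _)
    fun i _ => W.sum_post_le_one _

open Classical in
lemma card_jar_le {n : ℕ} (hn : 1 ≤ n) (d : ℝ) (y : Fin n → Y) :
    ((Finset.univ.filter fun x : Fin n → ZMod 2 => x ∈ W.jar d y).card : ℝ)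
      ≤ Real.exp (n * (W.condEntropy + d)) := by
  have h1 : ((Finset.univ.filter fun x : Fin n → ZMod 2 => x ∈ W.jar d y).card : ℝ)
      * Real.exp (-(n * (W.condEntropy + d))) ≤ 1 := by
    rw [← nsmul_eq_mul, ← Finset.sum_const]
    refine (Finset.sum_le_sum fun x hx =>
      ((W.mem_jar_iff hn).1 (Finset.mem_filter.1 hx).2).2).trans ?_
    exact (Finset.sum_le_sum_of_subset_of_nonneg (Finset.subset_univ _) fun x _ _ =>
      Finset.prod_nonneg fun i _ => W.post_nonneg _ _).trans (W.sum_prod_post_le_one y)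
  rw [Real.exp_neg, ← div_eq_mul_inv, div_le_one (Real.exp_pos _)] at h1
  exact h1

lemma measurableSet_mem_jar {n : ℕ} (hn : 1 ≤ n) (d : ℝ) (x : Fin n → ZMod 2) :
    MeasurableSet {y : Fin n → Y | x ∈ W.jar d y} := by
  have hm : Measurable fun y : Fin n → Y => ∏ i, W.post (x i) (y i) :=
    Finset.measurable_prod _ fun i _ =>
      W.measurable_post.comp (measurable_const.prodMk (measurable_pi_apply i))
  simp_rw [W.mem_jar_iff hn]
  exact (measurableSet_lt measurable_const hm).inter (measurableSet_le measurable_const hm)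

instance {n : ℕ} (x : Fin n → ZMod 2) : IsProbabilityMeasure (W.outBlock x) := by
  unfold outBlock
  infer_instance

/-- When `x` is sent, its likelihood is almost surely positive, so the logarithm of the product of
posteriors splits into a sum. -/
lemma ae_not_mem_jar_iff {n : ℕ} (hn : 1 ≤ n) (d : ℝ) (x : Fin n → ZMod 2) :
    ∀ᵐ y ∂(W.outBlock x), x ∉ W.jar d y ↔
      n * (W.condEntropy + d) < ∑ i, W.info (x i, y i) := by
  have h : ∀ᵐ y ∂(W.outBlock x), ∀ i, 0 < W.dens (x i) (y i) := by
    rw [ae_all_iff]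
    intro i
    exact (Measure.tendsto_eval_ae_ae (μ := fun i => W.out (x i)) (i := i)).eventually
      (W.ae_dens_pos (x i))
  filter_upwards [h] with y hy
  have hp : ∀ i, 0 < W.post (x i) (y i) := fun i => W.post_pos (hy i)
  have hpos : 0 < ∏ i, W.post (x i) (y i) := Finset.prod_pos fun i _ => hp i
  rw [W.mem_jar_iff hn, and_iff_right hpos, not_le, ← Real.log_lt_iff_lt_exp hpos,
    Real.log_prod fun i _ => (hp i).ne', lt_neg, ← Finset.sum_neg_distrib]
  rfl

lemma pi_joint_real_eq {n : ℕ} (hn : 1 ≤ n) (d : ℝ) :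
    (Measure.pi fun _ : Fin n => W.joint).real
        {z | n * (W.condEntropy + d) < ∑ i, W.info (z i)}
      = (2 ^ n : ℝ)⁻¹ * ∑ x : Fin n → ZMod 2, (W.outBlock x).real {y | x ∉ W.jar d y} := by
  have hm : Measurable fun z : Fin n → ZMod 2 × Y => ∑ i, W.info (z i) :=
    Finset.measurable_sum _ fun i _ => W.measurable_info.comp (measurable_pi_apply i)
  have hs : MeasurableSet {z : Fin n → ZMod 2 × Y | n * (W.condEntropy + d) < ∑ i, W.info (z i)} :=
    measurableSet_lt measurable_const hm
  rw [Measure.real, W.pi_joint, Measure.smul_apply, Measure.finsetSum_apply, smul_eq_mul,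
    ENNReal.toReal_mul, ENNReal.toReal_sum]
  · congr 1
    · simp
    · refine Finset.sum_congr rfl fun x _ => ?_
      rw [Measure.map_apply (by fun_prop) hs, Measure.real]
      congr 1
      refine measure_congr ?_
      filter_upwards [W.ae_not_mem_jar_iff hn d x] with y hy
      exact propext hy.symm
  · intro x _
    rw [Measure.map_apply (by fun_prop) hs]
    exact measure_ne_top _ _

lemma avgError_le_one {m n : ℕ} (g : Decoder Y m n) : W.avgError g ≤ 1 := by
  have hc : (0 : ℝ) < Fintype.card (Matrix (Fin m) (Fin n) (ZMod 2)) := by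
    exact_mod_cast Fintype.card_pos
  rw [avgError, inv_mul_le_iff₀ hc, mul_one]
  calc _ ≤ ∑ _H : Matrix (Fin m) (Fin n) (ZMod 2), (1 : ℝ) := by
        refine Finset.sum_le_sum fun H _ => ?_
        calc _ ≤ ((codewords H).card : ℝ)⁻¹ * ∑ _x ∈ codewords H, (1 : ℝ) := by
              gcongr
              exact measureReal_le_one
          _ ≤ 1 := by
              rw [Finset.sum_const, nsmul_eq_mul, mul_one]
              exact inv_mul_le_one
    _ = _ := by simp

open Classical in
-- On the event that `x` is in the jar, the jar has room for at most `exp (n (H + d)) - 1`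
-- competitors; off it there is nothing to count.
lemma sum_jar_pairs_le {n : ℕ} (hn : 1 ≤ n) (d : ℝ) (x : Fin n → ZMod 2) :
    ∑ x' ∈ Finset.univ.erase x, (W.outBlock x).real {y | x ∈ W.jar d y ∧ x' ∈ W.jar d y}
      ≤ (Real.exp (n * (W.condEntropy + d)) - 1) * (1 - (W.outBlock x).real {y | x ∉ W.jar d y}) := by
  have hms := W.measurableSet_mem_jar hn d
  have h1 : 1 - (W.outBlock x).real {y | x ∉ W.jar d y}
      = (W.outBlock x).real {y | x ∈ W.jar d y} := by
    have : {y : Fin n → Y | x ∉ W.jar d y} = {y | x ∈ W.jar d y}ᶜ := rfl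
    rw [this, probReal_compl_eq_one_sub (hms x)]
    ring
  have h2 : ∀ s : Set (Fin n → Y), MeasurableSet s →
      (W.outBlock x).real s = ∫ y, s.indicator 1 y ∂(W.outBlock x) := fun s hs =>
    (integral_indicator_one hs).symm
  have hi : ∀ s : Set (Fin n → Y), MeasurableSet s →
      Integrable (s.indicator (1 : (Fin n → Y) → ℝ)) (W.outBlock x) := fun s hs =>
    (integrable_const (1 : ℝ)).indicator hs
  have h3 : ∀ x', (W.outBlock x).real {y | x ∈ W.jar d y ∧ x' ∈ W.jar d y}
      = ∫ y, ({y | x ∈ W.jar d y} ∩ {y | x' ∈ W.jar d y}).indicator 1 y ∂(W.outBlock x) :=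
    fun x' => h2 _ ((hms x).inter (hms x'))
  rw [h1, Finset.sum_congr rfl fun x' _ => h3 x',
    ← integral_finsetSum _ fun x' _ => hi _ ((hms x).inter (hms x')), h2 _ (hms x),
    ← integral_const_mul]
  refine integral_mono (integrable_finsetSum _ fun x' _ => hi _ ((hms x).inter (hms x')))
    ((hi _ (hms x)).const_mul _) fun y => ?_
  simp only [Set.indicator_apply, Set.mem_ofPred_eq, Pi.one_apply, Set.mem_inter_iff]
  by_cases hx : x ∈ W.jar d y
  · simp only [hx, true_and, if_true, mul_one]
    rw [Finset.sum_boole]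
    have h3 : (Finset.univ.erase x).filter (fun x' => x' ∈ W.jar d y)
        = (Finset.univ.filter fun x' => x' ∈ W.jar d y).erase x := by
      ext x'
      simp
    rw [h3, Finset.card_erase_of_mem (by simpa using hx),
      Nat.cast_sub (Finset.card_pos.2 ⟨x, by simpa using hx⟩), Nat.cast_one]
    exact sub_le_sub_right (W.card_jar_le hn d y) 1
  · simp [hx]

/-- The union bound holds for every tie-breaking rule. Monotonicity of the measure is enough, so the
decoder need not be measurable. -/
lemma outBlock_error_le {m n : ℕ} {d : ℝ} {g : Decoder Y m n} (hg : W.IsJarDecoder d g)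
    (H : Matrix (Fin m) (Fin n) (ZMod 2)) {x : Fin n → ZMod 2} (hx : x ∈ codewords H) :
    (W.outBlock x).real {y | g H y ≠ some x} ≤ (W.outBlock x).real {y | x ∉ W.jar d y}
      + ∑ x' ∈ (codewords H).erase x,
          (W.outBlock x).real {y | x ∈ W.jar d y ∧ x' ∈ W.jar d y} := by
  have hsub : {y | g H y ≠ some x} ⊆ {y | x ∉ W.jar d y} ∪
      ⋃ x' ∈ (codewords H).erase x, {y | x ∈ W.jar d y ∧ x' ∈ W.jar d y} := by
    intro y hy
    by_cases hxy : x ∈ W.jar d y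
    · obtain ⟨x', hx', hx'y, hgx'⟩ := (hg H y).2 ⟨x, hx, hxy⟩
      have hne : x' ≠ x := by
        rintro rfl
        exact hy hgx'
      refine Or.inr (Set.mem_biUnion (Finset.mem_erase.2 ⟨hne, hx'⟩) ⟨hxy, hx'y⟩)
    · exact Or.inl hxy
  refine (measureReal_mono hsub (measure_ne_top _ _)).trans
    ((measureReal_union_le _ _).trans ?_)
  gcongr
  exact measureReal_biUnion_finset_le _ _

/-- Jar decoding over the random linear code: the error probability is at most the probability that
the information density is atypically large, plus the normalized maximal size of a jar. -/
theorem avgError_le {m n : ℕ} (hmn : m < n) {d : ℝ} {g : Decoder Y m n}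
    (hg : W.IsJarDecoder d g) :
    W.avgError g ≤ (Measure.pi fun _ : Fin n => W.joint).real
        {z | n * (W.condEntropy + d) < ∑ i, W.info (z i)}
      + (2 ^ m : ℝ)⁻¹ * Real.exp (n * (W.condEntropy + d)) := by
  have hn : 1 ≤ n := by omega
  set L := Real.exp (n * (W.condEntropy + d)) with hL
  have hL0 : 0 < L := Real.exp_pos _
  rcases lt_or_ge L 1 with hL1 | hL1
  -- A jar with fewer than one word is empty, so the tail probability is already 1.
  · have hemp : ∀ (x : Fin n → ZMod 2) (y : Fin n → Y), x ∉ W.jar d y := fun x y hxy => by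
      classical
      have h1 := W.card_jar_le hn d y
      have h2 : 1 ≤ (Finset.univ.filter fun x : Fin n → ZMod 2 => x ∈ W.jar d y).card :=
        Finset.card_pos.2 ⟨x, by simpa using hxy⟩
      have h3 : (1 : ℝ) ≤ ((Finset.univ.filter fun x : Fin n → ZMod 2 => x ∈ W.jar d y).card : ℝ) :=
        by exact_mod_cast h2
      linarith
    have h4 : (Measure.pi fun _ : Fin n => W.joint).real
        {z | n * (W.condEntropy + d) < ∑ i, W.info (z i)} = 1 := by
      rw [W.pi_joint_real_eq hn]
      simp [hemp, ZMod.card]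
    rw [h4]
    exact (W.avgError_le_one g).trans (le_add_of_nonneg_right (by positivity))
  · rcases Nat.eq_zero_or_pos m with rfl | hm
    · refine (W.avgError_le_one g).trans ?_
      rw [pow_zero, inv_one, one_mul]
      exact hL1.trans (le_add_of_nonneg_left measureReal_nonneg)
    · rw [W.pi_joint_real_eq hn]
      exact average_error_le hm hmn hL1 (fun x => measureReal_nonneg) (fun x => measureReal_le_one)
        (b := fun x x' => (W.outBlock x).real {y | x ∈ W.jar d y ∧ x' ∈ W.jar d y})
        (fun x x' => measureReal_nonneg) (fun x => W.sum_jar_pairs_le hn d x)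
        fun H x hx => W.outBlock_error_le hg H hx

end BIMC

/-! ### Exponentially weighted tails under a normal approximation -/

/-- The law of an exponential random variable with rate `a`. -/
def expLaw (a : ℝ) : Measure ℝ :=
  (volume.restrict (Set.Ioi 0)).withDensity fun t => ENNReal.ofReal (a * Real.exp (-a * t))

lemma integrableOn_mul_exp_Ioi {a : ℝ} (ha : 0 < a) (v : ℝ) :
    IntegrableOn (fun t => a * Real.exp (-a * t)) (Set.Ioi v) :=
  (integrableOn_exp_mul_Ioi (by linarith) v).const_mul a

lemma integral_mul_exp_Ioi {a : ℝ} (ha : 0 < a) (v : ℝ) :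
    ∫ t in Set.Ioi v, a * Real.exp (-a * t) = Real.exp (-a * v) := by
  rw [integral_const_mul, integral_exp_mul_Ioi (by linarith)]
  field_simp

lemma expLaw_real_Ioi {a : ℝ} (ha : 0 < a) {v : ℝ} (hv : 0 ≤ v) :
    (expLaw a).real (Set.Ioi v) = Real.exp (-a * v) := by
  rw [Measure.real, expLaw, withDensity_apply _ measurableSet_Ioi,
    Measure.restrict_restrict measurableSet_Ioi, Set.Ioi_inter_Ioi, max_eq_left hv,
    ← ofReal_integral_eq_lintegral_ofReal (integrableOn_mul_exp_Ioi ha v)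
      (ae_of_all _ fun t => by positivity), integral_mul_exp_Ioi ha,
    ENNReal.toReal_ofReal (Real.exp_pos _).le]

lemma isProbabilityMeasure_expLaw {a : ℝ} (ha : 0 < a) : IsProbabilityMeasure (expLaw a) where
  measure_univ := by
    rw [expLaw, withDensity_apply _ MeasurableSet.univ, Measure.restrict_univ,
      ← ofReal_integral_eq_lintegral_ofReal (integrableOn_mul_exp_Ioi ha 0)
      (ae_of_all _ fun t => by positivity), integral_mul_exp_Ioi ha]
    simp

lemma integral_expLaw {a : ℝ} (ha : 0 < a) (F : ℝ → ℝ) :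
    ∫ t, F t ∂(expLaw a) = ∫ t in Set.Ioi 0, a * Real.exp (-a * t) * F t := by
  rw [expLaw, integral_withDensity_eq_integral_toReal_smul (by fun_prop)
    (ae_of_all _ fun t => ENNReal.ofReal_lt_top)]
  refine integral_congr_ae (ae_of_all _ fun t => ?_)
  simp only
  rw [ENNReal.toReal_ofReal (by positivity), smul_eq_mul]

lemma integral_exp_mul_gaussQ (a c ρ : ℝ) :
    ∫ t in (0 : ℝ)..ρ, a * Real.exp (-a * t) * (c - gaussQ t)
      = (c - 1 / 2) - Real.exp (-a * ρ) * (c - gaussQ ρ)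
        + Real.exp (a ^ 2 / 2) * (gaussQ a - gaussQ (ρ + a)) := by
  have h : ∀ t ∈ Set.uIcc (0 : ℝ) ρ, HasDerivAt
      (fun t => -(Real.exp (-a * t) * (c - gaussQ t)) - Real.exp (a ^ 2 / 2) * gaussQ (t + a))
      (a * Real.exp (-a * t) * (c - gaussQ t)) t := fun t _ => by
    have h1 : HasDerivAt (fun t : ℝ => Real.exp (-a * t)) (Real.exp (-a * t) * -a) t := by
      simpa using ((hasDerivAt_id t).const_mul (-a)).exp
    have h2 := (hasDerivAt_gaussQ t).const_sub c
    have h3 := ((hasDerivAt_gaussQ (t + a)).comp_add_const t a).const_mul (Real.exp (a ^ 2 / 2))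
    refine ((h1.mul h2).neg.sub h3).congr_deriv ?_
    have h4 : Real.exp (-(t + a) ^ 2 / 2)
        = Real.exp (-a * t) * Real.exp (-t ^ 2 / 2) * (Real.exp (a ^ 2 / 2))⁻¹ := by
      rw [← Real.exp_neg, ← Real.exp_add, ← Real.exp_add]
      congr 1
      ring
    rw [h4]
    field_simp
    ring
  have hc : Continuous fun t => a * Real.exp (-a * t) * (c - gaussQ t) := by
    have := continuous_gaussQ
    fun_prop
  rw [intervalIntegral.integral_eq_sub_of_hasDerivAt h (hc.intervalIntegrable _ _)]
  simp [gaussQ_zero]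
  ring

/-- For `V > 0`, `exp (-a V)` is the probability that an independent exponential variable of rate
`a` exceeds `V`. By Fubini the integral becomes `∫ a exp (-a t) P(0 < V < t) dt`. The probability is
at most `2 B + 1 / 2 - gaussQ t`, used up to `ρ`, and at most `1 / 2 + B`, used beyond it; the two
bounds cross where `gaussQ t = B`. -/
lemma integral_indicator_exp_le {Ω : Type*} [MeasurableSpace Ω] {P : Measure Ω}
    [IsProbabilityMeasure P] {V : Ω → ℝ} (hV : Measurable V) {a B ρ : ℝ} (ha : 0 < a)
    (hP : ∀ t, |P.real {w | t < V w} - gaussQ t| ≤ B) (hρ0 : 0 ≤ ρ) (hρ : gaussQ ρ ≤ B) :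
    ∫ w, {w | 0 < V w}.indicator (fun w => Real.exp (-a * V w)) w ∂P
      ≤ 2 * B + Real.exp (a ^ 2 / 2) * (gaussQ a - gaussQ (ρ + a)) := by
  have := isProbabilityMeasure_expLaw ha
  have hs : MeasurableSet {p : Ω × ℝ | 0 < V p.1 ∧ V p.1 < p.2} :=
    (measurableSet_lt measurable_const (hV.comp measurable_fst)).inter
      (measurableSet_lt (hV.comp measurable_fst) measurable_snd)
  have hswap := integral_measureReal_swap (μ := P) (κ := expLaw a) hs
  have h1 : ∀ w, {w | 0 < V w}.indicator (fun w => Real.exp (-a * V w)) w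
      = (expLaw a).real {t | (w, t) ∈ {p : Ω × ℝ | 0 < V p.1 ∧ V p.1 < p.2}} := fun w => by
    by_cases hw : 0 < V w
    · rw [Set.indicator_of_mem (by exact hw), ← expLaw_real_Ioi ha hw.le]
      congr 1
      ext t
      simp [hw]
    · rw [Set.indicator_of_notMem (by exact hw)]
      simp [hw]
  simp_rw [h1]
  rw [hswap, integral_expLaw ha]
  set G : ℝ → ℝ := fun t => P.real {w | (w, t) ∈ {p : Ω × ℝ | 0 < V p.1 ∧ V p.1 < p.2}} with hG
  have hGmono : Monotone G := fun s t hst =>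
    measureReal_mono (fun w hw => ⟨hw.1, lt_of_lt_of_le hw.2 hst⟩)
  have hG1 : ∀ t, G t ≤ 1 / 2 + B := fun t => by
    have h2 : G t ≤ P.real {w | 0 < V w} := measureReal_mono fun w hw => hw.1
    have h3 := (abs_le.1 (hP 0)).2
    rw [gaussQ_zero] at h3
    linarith
  have hG2 : ∀ t, 0 ≤ t → G t ≤ 2 * B + 1 / 2 - gaussQ t := fun t ht => by
    have hsub : {w | t < V w} ⊆ {w | 0 < V w} := fun w hw => lt_of_le_of_lt ht hw
    have h2 : G t ≤ P.real ({w | 0 < V w} \ {w | t < V w}) :=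
      measureReal_mono fun w hw => ⟨hw.1, not_lt.2 (le_of_lt hw.2)⟩
    rw [measureReal_sdiff hsub (measurableSet_lt measurable_const hV)] at h2
    have h3 := (abs_le.1 (hP 0)).2
    have h4 := (abs_le.1 (hP t)).1
    rw [gaussQ_zero] at h3
    linarith
  have hGint : IntegrableOn (fun t => a * Real.exp (-a * t) * G t) (Set.Ioi 0) := by
    refine Integrable.mono' (integrableOn_mul_exp_Ioi ha 0) ?_ (ae_of_all _ fun t => ?_)
    · have := hGmono.measurable
      exact Measurable.aestronglyMeasurable (by fun_prop)
    · rw [norm_mul, Real.norm_of_nonneg (by positivity : 0 ≤ a * Real.exp (-a * t))]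
      refine mul_le_of_le_one_right (by positivity) ?_
      rw [Real.norm_of_nonneg measureReal_nonneg]
      exact measureReal_le_one
  rw [← Set.Ioc_union_Ioi_eq_Ioi hρ0, setIntegral_union (Set.Ioc_disjoint_Ioi le_rfl)
    measurableSet_Ioi (hGint.mono_set Set.Ioc_subset_Ioi_self)
    (hGint.mono_set (Set.Ioi_subset_Ioi hρ0)), ← intervalIntegral.integral_of_le hρ0]
  have hc : Continuous fun t => a * Real.exp (-a * t) * (2 * B + 1 / 2 - gaussQ t) := by
    have := continuous_gaussQ
    fun_prop
  have e1 : ∫ t in (0 : ℝ)..ρ, a * Real.exp (-a * t) * G t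
      ≤ ∫ t in (0 : ℝ)..ρ, a * Real.exp (-a * t) * (2 * B + 1 / 2 - gaussQ t) := by
    refine intervalIntegral.integral_mono_on hρ0 ?_ (hc.intervalIntegrable _ _) fun t ht => ?_
    · rw [intervalIntegrable_iff_integrableOn_Ioc_of_le hρ0]
      exact hGint.mono_set Set.Ioc_subset_Ioi_self
    · exact mul_le_mul_of_nonneg_left (hG2 t ht.1) (by positivity)
  have e2 : ∫ t in Set.Ioi ρ, a * Real.exp (-a * t) * G t
      ≤ ∫ t in Set.Ioi ρ, a * Real.exp (-a * t) * (1 / 2 + B) := by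
    refine integral_mono (hGint.mono_set (Set.Ioi_subset_Ioi hρ0))
      ((integrableOn_mul_exp_Ioi ha ρ).mul_const _) fun t => ?_
    exact mul_le_mul_of_nonneg_left (hG1 t) (by positivity)
  rw [integral_exp_mul_gaussQ] at e1
  rw [integral_mul_const, integral_mul_exp_Ioi ha] at e2
  -- The boundary terms at `ρ` from the two pieces combine into this product, which may be dropped.
  have e3 : Real.exp (-a * ρ) * (gaussQ ρ - B) ≤ 0 :=
    mul_nonpos_of_nonneg_of_nonpos (Real.exp_pos _).le (by linarith)
  linarith

/-! ### Sums of independent copies of a random variable -/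

lemma pi_withDensity {ι Ω : Type*} [Fintype ι] [MeasurableSpace Ω] (μ : Measure Ω)
    [IsProbabilityMeasure μ] {f : Ω → ℝ≥0∞} (hf : Measurable f)
    [SigmaFinite (μ.withDensity f)] :
    Measure.pi (fun _ : ι => μ.withDensity f)
      = (Measure.pi fun _ : ι => μ).withDensity fun z => ∏ i, f (z i) := by
  refine Measure.pi_eq fun s hs => ?_
  rw [withDensity_apply _ (MeasurableSet.univ_pi hs),
    ← lintegral_indicator (MeasurableSet.univ_pi hs)]
  have h1 : ∀ z : ι → Ω, (Set.univ.pi s).indicator (fun z => ∏ i, f (z i)) z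
      = ∏ i, (s i).indicator f (z i) := fun z => by
    by_cases hz : z ∈ Set.univ.pi s
    · rw [Set.indicator_of_mem hz]
      exact Finset.prod_congr rfl fun i _ => by
        rw [Set.indicator_of_mem (hz i (Set.mem_univ i))]
    · rw [Set.indicator_of_notMem hz]
      obtain ⟨i, hi⟩ : ∃ i, z i ∉ s i := by simpa [Set.mem_pi] using hz
      exact (Finset.prod_eq_zero (Finset.mem_univ i) (Set.indicator_of_notMem hi f)).symm
  have hm : ∀ i, Measurable ((s i).indicator f) := fun i => hf.indicator (hs i)
  simp_rw [h1]
  rw [ProbabilityTheory.lintegral_prod_eq_prod_lintegral_of_indepFun Finset.univ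
    (fun i (z : ι → Ω) => (s i).indicator f (z i))
    (ProbabilityTheory.iIndepFun_pi fun i => (hm i).aemeasurable)
    fun i => (hm i).comp (measurable_pi_apply i)]
  refine Finset.prod_congr rfl fun i _ => ?_
  rw [withDensity_apply _ (hs i), ← lintegral_indicator (hs i)]
  exact ((measurePreserving_eval (fun _ : ι => μ) i).lintegral_comp (hm i))

section Sums

variable {Ω : Type*} [MeasurableSpace Ω]

lemma IsBerryEsseenConst.abs_sub_le {C : ℝ} (hC : IsBerryEsseenConst C) {P : Measure Ω}
    [IsProbabilityMeasure P] {X : Ω → ℝ} (hX : Measurable X) (hXi : Integrable X P)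
    (h3 : Integrable (fun w => |X w - ∫ w, X w ∂P| ^ 3) P)
    (h2 : 0 < ∫ w, |X w - ∫ w, X w ∂P| ^ 2 ∂P) {n : ℕ} (hn : 1 ≤ n) (t : ℝ) :
    |(Measure.pi fun _ : Fin n => P).real
        {z | t < (∑ i, (X (z i) - ∫ w, X w ∂P))
          / (Real.sqrt n * Real.sqrt (∫ w, |X w - ∫ w, X w ∂P| ^ 2 ∂P))} - gaussQ t|
      ≤ C * (∫ w, |X w - ∫ w, X w ∂P| ^ 3 ∂P)
          / (Real.sqrt n * Real.sqrt (∫ w, |X w - ∫ w, X w ∂P| ^ 2 ∂P) ^ 3) := by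
  set m := ∫ w, X w ∂P with hm
  have hY : Measurable fun w => X w - m := hX.sub_const m
  have hemb : ∀ f : ℝ → ℝ, Measurable f →
      ∫ v, f v ∂(P.map fun w => X w - m) = ∫ w, f (X w - m) ∂P := fun f hf =>
    integral_map hY.aemeasurable hf.aestronglyMeasurable
  have hprob : IsProbabilityMeasure (P.map fun w => X w - m) :=
    Measure.isProbabilityMeasure_map hY.aemeasurable
  have hsq : ∫ v, v ^ 2 ∂(P.map fun w => X w - m) = ∫ w, |X w - m| ^ 2 ∂P := by
    rw [hemb (fun v => v ^ 2) (by fun_prop)]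
    simp_rw [sq_abs]
  have := hC (P.map fun w => X w - m) hprob
    (by
      rw [integrable_map_measure (by fun_prop) hY.aemeasurable]
      exact h3)
    (by
      rw [hemb (fun v => v) (by fun_prop), integral_sub hXi (integrable_const _)]
      simp [← hm])
    (by rw [hsq]; exact h2) n hn t
  rw [hsq, hemb (fun v => |v| ^ 3) (by fun_prop), ← Measure.pi_map_pi (fun _ => hY.aemeasurable),
    map_measureReal_apply (by fun_prop) (measurableSet_lt measurable_const (by fun_prop))] at this
  have hpos : 0 < Real.sqrt n * Real.sqrt (∫ w, |X w - m| ^ 2 ∂P) :=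
    mul_pos (Real.sqrt_pos.2 (by exact_mod_cast hn)) (Real.sqrt_pos.2 h2)
  simp_rw [lt_div_iff₀ hpos]
  exact this

/-- Tilting back by `-l X` recovers `P` from its tilt, with density `exp (cgf - l X)`; densities
multiply over the coordinates. -/
lemma pi_real_eq_integral_tilted {P : Measure Ω} [IsProbabilityMeasure P] {X : Ω → ℝ}
    (hX : Measurable X) {l : ℝ} (hl : Integrable (fun w => Real.exp (l * X w)) P) {n : ℕ}
    {s : Set (Fin n → Ω)} (hs : MeasurableSet s) :
    (Measure.pi fun _ : Fin n => P).real s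
      = ∫ z in s, Real.exp (n * ProbabilityTheory.cgf X P l - l * ∑ i, X (z i))
          ∂(Measure.pi fun _ : Fin n => P.tilted (l * X ·)) := by
  have hprob : IsProbabilityMeasure (P.tilted (l * X ·)) := isProbabilityMeasure_tilted hl
  have hmgf : 0 < ProbabilityTheory.mgf X P l := ProbabilityTheory.mgf_pos hl
  have h1 : (P.tilted (l * X ·)).withDensity
      (fun w => ENNReal.ofReal (Real.exp (ProbabilityTheory.cgf X P l - l * X w))) = P := by
    conv_rhs => rw [← tilted_neg_same hl, Measure.tilted, integral_exp_tilted]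
    congr 1
    funext w
    congr 1
    have h2 : ∫ w, Real.exp (((fun w => l * X w) + -fun w => l * X w) w) ∂P = 1 := by simp
    rw [h2, ProbabilityTheory.cgf, Real.exp_sub, Real.exp_log hmgf, ProbabilityTheory.mgf,
      Pi.neg_apply, Real.exp_neg]
    field_simp
  have hsf : IsProbabilityMeasure ((P.tilted (l * X ·)).withDensity
      (fun w => ENNReal.ofReal (Real.exp (ProbabilityTheory.cgf X P l - l * X w)))) := by
    rw [h1]; infer_instance
  conv_lhs => rw [← h1]
  rw [pi_withDensity _ (by fun_prop), Measure.real, withDensity_apply _ hs,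
    integral_eq_lintegral_of_nonneg_ae (ae_of_all _ fun z => (Real.exp_pos _).le)
      (Measurable.aestronglyMeasurable (by fun_prop))]
  congr 1
  refine lintegral_congr fun z => ?_
  rw [← ENNReal.ofReal_prod_of_nonneg fun i _ => (Real.exp_pos _).le, ← Real.exp_sum,
    Finset.sum_sub_distrib, ← Finset.mul_sum]
  simp

/-- The exact asymptotics upper bound for the upper tail of a sum of independent copies of `X`,
from the normal approximation under the tilted law. -/
theorem pi_real_sum_gt_le {C : ℝ} (hC : IsBerryEsseenConst C) {P : Measure Ω}
    [IsProbabilityMeasure P] {X : Ω → ℝ} (hX : Measurable X) {l m s2 M3 B ρ : ℝ} (hl0 : 0 < l)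
    (hl : Integrable (fun w => Real.exp (l * X w)) P)
    (hXi : Integrable X (P.tilted (l * X ·)))
    (h3 : Integrable (fun w => |X w - m| ^ 3) (P.tilted (l * X ·)))
    (hm : m = ∫ w, X w ∂(P.tilted (l * X ·)))
    (hs2 : s2 = ∫ w, |X w - m| ^ 2 ∂(P.tilted (l * X ·))) (hs0 : 0 < s2)
    (hM3 : M3 = ∫ w, |X w - m| ^ 3 ∂(P.tilted (l * X ·))) {n : ℕ} (hn : 1 ≤ n)
    (hB : B = C * M3 / (Real.sqrt n * Real.sqrt s2 ^ 3)) (hρ0 : 0 ≤ ρ) (hρ : gaussQ ρ ≤ B) :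
    (Measure.pi fun _ : Fin n => P).real {z | n * m < ∑ i, X (z i)}
      ≤ (2 * B + Real.exp (n * l ^ 2 * s2 / 2) * (gaussQ (Real.sqrt n * l * Real.sqrt s2)
          - gaussQ (ρ + Real.sqrt n * l * Real.sqrt s2)))
        * Real.exp (-n * (l * m - ProbabilityTheory.cgf X P l)) := by
  have hprob : IsProbabilityMeasure (P.tilted (l * X ·)) := isProbabilityMeasure_tilted hl
  have hn0 : (0 : ℝ) < n := by exact_mod_cast hn
  set σ := Real.sqrt s2 with hσ
  have hσ0 : 0 < σ := Real.sqrt_pos.2 hs0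
  have hsn : 0 < Real.sqrt n := Real.sqrt_pos.2 hn0
  set V : (Fin n → Ω) → ℝ := fun z => (∑ i, (X (z i) - m)) / (Real.sqrt n * σ) with hVdef
  have hV : Measurable V := by fun_prop
  have hBE : ∀ t, |(Measure.pi fun _ : Fin n => P.tilted (l * X ·)).real {z | t < V z} - gaussQ t|
      ≤ B := fun t => by
    have := hC.abs_sub_le hX hXi (by rw [← hm]; exact h3) (by rw [← hm, ← hs2]; exact hs0) hn t
    rw [← hm, ← hs2, ← hM3] at this
    rw [hB]
    exact this
  have hmain := integral_indicator_exp_le hV (a := Real.sqrt n * l * σ) (by positivity) hBE hρ0 hρ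
  have hset : {z : Fin n → Ω | n * m < ∑ i, X (z i)} = {z | 0 < V z} := by
    ext z
    simp only [Set.mem_ofPred_eq, hVdef]
    rw [div_pos_iff_of_pos_right (by positivity), Finset.sum_sub_distrib]
    simp
  rw [hset, pi_real_eq_integral_tilted hX hl (measurableSet_lt measurable_const hV)]
  have hexp : ∀ z : Fin n → Ω, Real.exp (n * ProbabilityTheory.cgf X P l - l * ∑ i, X (z i))
      = Real.exp (-n * (l * m - ProbabilityTheory.cgf X P l))
        * Real.exp (-(Real.sqrt n * l * σ) * V z) := fun z => by
    rw [← Real.exp_add]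
    congr 1
    have : Real.sqrt n * l * σ * V z = l * (∑ i, X (z i) - n * m) := by
      simp only [hVdef]
      rw [Finset.sum_sub_distrib]
      simp
      field_simp
    rw [neg_mul (Real.sqrt n * l * σ), this]
    ring
  simp_rw [hexp]
  rw [integral_const_mul, mul_comm, ← integral_indicator (measurableSet_lt measurable_const hV)]
  refine mul_le_mul_of_nonneg_right ?_ (Real.exp_pos _).le
  refine hmain.trans (le_of_eq ?_)
  have : (Real.sqrt n * l * σ) ^ 2 = n * l ^ 2 * s2 := by
    rw [mul_pow, mul_pow, Real.sq_sqrt hn0.le, hσ, Real.sq_sqrt hs0.le]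
  rw [this]

end Sums

/-! ### Legendre transforms of cumulant generating functions -/

section Cgf

open ProbabilityTheory

variable {Ω : Type*} [MeasurableSpace Ω] {P : Measure Ω} {X : Ω → ℝ}

lemma integrable_exp_of_mem_interior {l : ℝ} (hl : l ∈ interior (integrableExpSet X P)) :
    Integrable (fun w => Real.exp (l * X w)) P :=
  integrable_of_mem_integrableExpSet (interior_subset hl)

variable [IsProbabilityMeasure P]

lemma integrable_tilted_of_mem_interior {l : ℝ} (hl : l ∈ interior (integrableExpSet X P)) :
    Integrable X (P.tilted (l * X ·)) := by
  have : IsProbabilityMeasure (P.tilted (l * X ·)) :=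
    isProbabilityMeasure_tilted (integrable_exp_of_mem_interior hl)
  exact (memLp_tilted_mul hl 1).integrable (by simp)

lemma integrable_abs_sub_pow_tilted {l : ℝ} (hl : l ∈ interior (integrableExpSet X P)) (m : ℝ)
    (k : ℕ) : Integrable (fun w => |X w - m| ^ k) (P.tilted (l * X ·)) := by
  have : IsProbabilityMeasure (P.tilted (l * X ·)) :=
    isProbabilityMeasure_tilted (integrable_exp_of_mem_interior hl)
  have h := (memLp_tilted_mul hl k).sub (memLp_const m)
  exact h.integrable_norm_pow'

/-- The tangent line at `l` lies below the convex function `cgf`, by `1 + x ≤ exp x` under the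
tilted law. Only integrability is asked of `l'`, so a finite boundary point of the domain is covered
in the supremum defining the rate. -/
lemma cgf_add_mul_le {l l' : ℝ} (hl : l ∈ interior (integrableExpSet X P))
    (hl' : Integrable (fun w => Real.exp (l' * X w)) P) :
    cgf X P l + (l' - l) * ∫ w, X w ∂(P.tilted (l * X ·)) ≤ cgf X P l' := by
  have hi : Integrable (fun w => Real.exp (l * X w)) P := integrable_exp_of_mem_interior hl
  have : IsProbabilityMeasure (P.tilted (l * X ·)) := isProbabilityMeasure_tilted hi
  set m := ∫ w, X w ∂(P.tilted (l * X ·)) with hm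
  have h1 : ∫ w, Real.exp ((l' - l) * X w) ∂(P.tilted (l * X ·)) = mgf X P l' / mgf X P l := by
    rw [integral_exp_tilted (fun w => l * X w) fun w => (l' - l) * X w, mgf, mgf]
    congr 2
    funext w
    simp only [Pi.add_apply]
    congr 1
    ring
  have hint : Integrable (fun w => Real.exp ((l' - l) * X w)) (P.tilted (l * X ·)) := by
    rw [integrable_tilted_iff hi]
    refine hl'.congr (ae_of_all _ fun w => ?_)
    simp only [smul_eq_mul]
    rw [← Real.exp_add]
    congr 1
    ring
  have hXi := integrable_tilted_of_mem_interior hl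
  have hXm : Integrable (fun w => (l' - l) * (X w - m)) (P.tilted (l * X ·)) :=
    (hXi.sub (integrable_const m)).const_mul _
  have h2 : Real.exp ((l' - l) * m) ≤ ∫ w, Real.exp ((l' - l) * X w) ∂(P.tilted (l * X ·)) := by
    have h3 : ∫ w, Real.exp ((l' - l) * m) * (1 + (l' - l) * (X w - m)) ∂(P.tilted (l * X ·))
        = Real.exp ((l' - l) * m) := by
      rw [integral_const_mul, integral_add (integrable_const _) hXm, integral_const_mul,
        integral_sub hXi (integrable_const m), ← hm]
      simp
    rw [← h3]
    refine integral_mono (((integrable_const _).add hXm).const_mul _) hint fun w => ?_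
    simp only
    have h4 : Real.exp ((l' - l) * X w)
        = Real.exp ((l' - l) * m) * Real.exp ((l' - l) * (X w - m)) := by
      rw [← Real.exp_add]
      congr 1
      ring
    rw [h4]
    refine mul_le_mul_of_nonneg_left ?_ (Real.exp_pos _).le
    linarith [Real.add_one_le_exp ((l' - l) * (X w - m))]
  have hpos := mgf_pos hi
  have hpos' := mgf_pos hl'
  rw [h1, ← Real.le_log_iff_exp_le (div_pos hpos' hpos),
    Real.log_div hpos'.ne' hpos.ne'] at h2
  simp only [cgf]
  linarith

end Cgf

namespace BIMC

open ProbabilityTheory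

variable {Y : Type*} [MeasurableSpace Y] (W : BIMC Y)

/-! ### Tilted channel statistics -/

lemma ae_post_rpow_eq (l : ℝ) :
    ∀ᵐ z ∂W.joint, W.post z.1 z.2 ^ (-l) = Real.exp (l * W.info z) := by
  filter_upwards [W.ae_post_pos] with z hz
  rw [Real.rpow_def_of_pos hz, info]
  congr 1
  ring

lemma partition_eq_lintegral (l : ℝ) :
    W.partition l = ∫⁻ z, ENNReal.ofReal (Real.exp (l * W.info z)) ∂W.joint := by
  refine lintegral_congr_ae ?_
  filter_upwards [W.ae_post_rpow_eq l] with z hz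
  rw [hz]

lemma partition_lt_top_iff (l : ℝ) :
    W.partition l < ∞ ↔ Integrable (fun z => Real.exp (l * W.info z)) W.joint := by
  have hm : AEStronglyMeasurable (fun z => Real.exp (l * W.info z)) W.joint := by
    have := W.measurable_info
    exact Measurable.aestronglyMeasurable (by fun_prop)
  rw [partition_eq_lintegral, Integrable, and_iff_right hm,
    hasFiniteIntegral_iff_ofReal (ae_of_all _ fun z => (Real.exp_pos _).le)]

lemma partition_eq_ofReal_mgf {l : ℝ}
    (h : Integrable (fun z => Real.exp (l * W.info z)) W.joint) :
    W.partition l = ENNReal.ofReal (mgf W.info W.joint l) := by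
  rw [partition_eq_lintegral, mgf,
    ofReal_integral_eq_lintegral_ofReal h (ae_of_all _ fun z => (Real.exp_pos _).le)]

lemma log_partition_eq {l : ℝ} (h : Integrable (fun z => Real.exp (l * W.info z)) W.joint) :
    ENNReal.log (W.partition l) = (cgf W.info W.joint l : EReal) := by
  rw [W.partition_eq_ofReal_mgf h, ENNReal.log_ofReal_of_pos (mgf_pos h), cgf]

/-- The information density is nonnegative, so every exponent below a finite one, including all
negative ones, is finite too. -/
lemma mem_interior_of_lt_lamStar {l : ℝ} (hl : (l : EReal) < W.lamStar) :
    l ∈ interior (integrableExpSet W.info W.joint) := by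
  obtain ⟨_, ⟨b, ⟨hb0, hb⟩, rfl⟩, hlb⟩ := lt_sSup_iff.1 hl
  have hlb' : l < b := EReal.coe_lt_coe_iff.1 hlb
  have hbi := (W.partition_lt_top_iff b).1 hb
  refine mem_interior.2 ⟨Set.Iio b, fun c hc => ?_, isOpen_Iio, hlb'⟩
  rcases le_total 0 c with h0 | h0
  · exact integrable_exp_mul_of_nonneg_of_le hbi h0 hc.le
  · refine (integrable_const (1 : ℝ)).mono' ?_ (ae_of_all _ fun z => ?_)
    · have := W.measurable_info
      exact Measurable.aestronglyMeasurable (by fun_prop)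
    · rw [Real.norm_of_nonneg (Real.exp_pos _).le, Real.exp_le_one_iff]
      exact mul_nonpos_of_nonpos_of_nonneg h0 (W.info_nonneg z)

lemma integral_tilt_mul {l : ℝ} (h : Integrable (fun z => Real.exp (l * W.info z)) W.joint)
    (F : ZMod 2 × Y → ℝ) :
    ∫ z, W.tilt l z * F z ∂W.joint = ∫ z, F z ∂(W.joint.tilted (l * W.info ·)) := by
  rw [integral_tilted_mul_eq_mgf]
  refine integral_congr_ae ?_
  filter_upwards [W.ae_post_rpow_eq l] with z hz
  rw [tilt, hz, W.partition_eq_ofReal_mgf h, ENNReal.toReal_ofReal mgf_nonneg, smul_eq_mul]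

lemma condEntropy_add_delta {l : ℝ}
    (h : Integrable (fun z => Real.exp (l * W.info z)) W.joint) :
    W.condEntropy + W.delta l = ∫ z, W.info z ∂(W.joint.tilted (l * W.info ·)) := by
  rw [delta, W.integral_tilt_mul h]
  ring

lemma sigmaSq_eq {l : ℝ} (h : Integrable (fun z => Real.exp (l * W.info z)) W.joint) :
    W.sigmaSq l = ∫ z, |W.info z - (W.condEntropy + W.delta l)| ^ 2
      ∂(W.joint.tilted (l * W.info ·)) := by
  rw [sigmaSq, W.integral_tilt_mul h]

lemma thirdMoment_toReal_eq {l : ℝ} (h : l ∈ interior (integrableExpSet W.info W.joint)) :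
    (W.thirdMoment l).toReal = ∫ z, |W.info z - (W.condEntropy + W.delta l)| ^ 3
      ∂(W.joint.tilted (l * W.info ·)) := by
  have hi : Integrable (fun z => Real.exp (l * W.info z)) W.joint := integrable_exp_of_mem_interior h
  rw [← W.integral_tilt_mul hi, thirdMoment, integral_eq_lintegral_of_nonneg_ae]
  · refine ae_of_all _ fun z => mul_nonneg (div_nonneg ?_ ENNReal.toReal_nonneg) (by positivity)
    exact Real.rpow_nonneg (W.post_nonneg _ _) _
  · have h1 := W.measurable_info
    have h2 := W.measurable_post
    unfold tilt
    exact Measurable.aestronglyMeasurable (by fun_prop)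

lemma zero_lt_lamStar_mem (hlam : 0 < W.lamStar) :
    (0 : ℝ) ∈ interior (integrableExpSet W.info W.joint) :=
  W.mem_interior_of_lt_lamStar (by simpa using hlam)

lemma delta_zero (hlam : 0 < W.lamStar) : W.delta 0 = 0 := by
  have h := W.condEntropy_add_delta (l := 0) (integrable_exp_of_mem_interior (W.zero_lt_lamStar_mem hlam))
  simp only [zero_mul, tilted_const] at h
  rw [← condEntropy] at h
  linarith

lemma variance_eq_sigmaSq {l : ℝ} (h : l ∈ interior (integrableExpSet W.info W.joint)) :
    Var[W.info; W.joint.tilted (l * W.info ·)] = W.sigmaSq l := by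
  have hi : Integrable (fun z => Real.exp (l * W.info z)) W.joint := integrable_exp_of_mem_interior h
  rw [W.sigmaSq_eq hi, W.condEntropy_add_delta hi, variance_eq_integral W.measurable_info.aemeasurable]
  simp_rw [sq_abs]

/-- The original law is absolutely continuous with respect to the tilted one, so an information
density constant under the tilt would be constant already. -/
lemma sigmaSq_pos (hsigma : 0 < W.sigmaSq 0) (hlam : 0 < W.lamStar) {l : ℝ}
    (h : l ∈ interior (integrableExpSet W.info W.joint)) : 0 < W.sigmaSq l := by
  have hi : Integrable (fun z => Real.exp (l * W.info z)) W.joint := integrable_exp_of_mem_interior h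
  have hprob : IsProbabilityMeasure (W.joint.tilted (l * W.info ·)) :=
    isProbabilityMeasure_tilted hi
  rw [← W.variance_eq_sigmaSq h]
  refine (variance_nonneg _ _).lt_of_ne fun h0 => ?_
  have hae := ae_eq_integral_of_variance_eq_zero (memLp_tilted_mul h 2) h0.symm
  have hae' := (absolutelyContinuous_tilted hi).ae_le hae
  have hconst : Var[W.info; W.joint] = 0 := by
    rw [variance_congr hae']
    simp [variance_eq_integral]
  have h1 := W.variance_eq_sigmaSq (W.zero_lt_lamStar_mem hlam)
  simp only [zero_mul, tilted_const] at h1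
  rw [← h1, hconst] at hsigma
  exact lt_irrefl _ hsigma

lemma delta_eq {l : ℝ} (h : l ∈ interior (integrableExpSet W.info W.joint)) :
    W.delta l = deriv (cgf W.info W.joint) l - W.condEntropy := by
  rw [← integral_tilted_mul_self h, ← W.condEntropy_add_delta (integrable_exp_of_mem_interior h)]
  ring

lemma isOpen_lt_lamStar : IsOpen {l : ℝ | (l : EReal) < W.lamStar} :=
  isOpen_lt continuous_coe_real_ereal continuous_const

lemma hasDerivAt_delta {l : ℝ} (h : (l : EReal) < W.lamStar) :
    HasDerivAt W.delta (W.sigmaSq l) l := by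
  have hl := W.mem_interior_of_lt_lamStar h
  have h1 : HasDerivAt (deriv (cgf W.info W.joint)) (W.sigmaSq l) l := by
    have h2 := (analyticAt_cgf hl).deriv.differentiableAt.hasDerivAt
    rwa [← iteratedDeriv_one, ← iteratedDeriv_succ, ← variance_tilted_mul hl,
      W.variance_eq_sigmaSq hl, iteratedDeriv_one] at h2
  refine (h1.sub_const W.condEntropy).congr_of_eventuallyEq ?_
  filter_upwards [W.isOpen_lt_lamStar.mem_nhds h] with b hb
  exact W.delta_eq (W.mem_interior_of_lt_lamStar hb)

lemma strictMonoOn_delta (hsigma : 0 < W.sigmaSq 0) (hlam : 0 < W.lamStar) :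
    StrictMonoOn W.delta {l : ℝ | (l : EReal) < W.lamStar} := by
  have hconv : Convex ℝ {l : ℝ | (l : EReal) < W.lamStar} := by
    refine (Set.OrdConnected.convex ⟨fun a _ b hb c hc => ?_⟩)
    exact lt_of_le_of_lt (EReal.coe_le_coe_iff.2 hc.2) hb
  refine strictMonoOn_of_deriv_pos hconv
    (fun l hl => (W.hasDerivAt_delta hl).continuousAt.continuousWithinAt) fun l hl => ?_
  have hl' := interior_subset hl
  rw [(W.hasDerivAt_delta hl').deriv]
  exact W.sigmaSq_pos hsigma hlam (W.mem_interior_of_lt_lamStar hl')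

/-! ### The limit of the mean of the tilted law -/

lemma eventually_toLamStar {b : ℝ} (hb : (b : EReal) < W.lamStar) :
    ∀ᶠ l in W.toLamStar, b < l ∧ (l : EReal) < W.lamStar := by
  have h : ∀ᶠ x in 𝓝[<] W.lamStar, (b : EReal) < x ∧ x < W.lamStar :=
    Ioo_mem_nhdsLT hb
  exact (h.comap _).mono fun l hl => ⟨by exact_mod_cast hl.1, hl.2⟩

lemma toLamStar_neBot (hlam : 0 < W.lamStar) : W.toLamStar.NeBot := by
  rw [toLamStar, comap_neBot_iff]
  intro t ht
  obtain ⟨a, ha, hat⟩ := (mem_nhdsLT_iff_exists_Ioo_subset' hlam).1 ht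
  obtain ⟨x, hx1, hx2⟩ := EReal.lt_iff_exists_real_btwn.1 (Set.mem_Iio.1 ha)
  exact ⟨x, hat ⟨hx1, hx2⟩⟩

lemma tendsto_delta (hsigma : 0 < W.sigmaSq 0) (hlam : 0 < W.lamStar) :
    Tendsto (fun l : ℝ => (W.delta l : EReal)) W.toLamStar
      (𝓝 (⨆ l : {l : ℝ | (l : EReal) < W.lamStar}, (W.delta l : EReal))) := by
  refine tendsto_order.2 ⟨fun c hc => ?_, fun c hc => ?_⟩
  · obtain ⟨⟨b, hb⟩, hcb⟩ := lt_iSup_iff.1 hc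
    filter_upwards [W.eventually_toLamStar hb] with l hl
    exact hcb.trans (by exact_mod_cast W.strictMonoOn_delta hsigma hlam hb hl.2 hl.1)
  · filter_upwards [W.eventually_toLamStar (b := 0) (by simpa using hlam)] with l hl
    exact lt_of_le_of_lt (le_iSup (fun l : {l : ℝ | (l : EReal) < W.lamStar} =>
      (W.delta l : EReal)) ⟨l, hl.2⟩) hc

lemma DeltaStar_eq (hsigma : 0 < W.sigmaSq 0) (hlam : 0 < W.lamStar) :
    W.DeltaStar = ⨆ l : {l : ℝ | (l : EReal) < W.lamStar}, (W.delta l : EReal) := by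
  have := W.toLamStar_neBot hlam
  exact (W.tendsto_delta hsigma hlam).limsup_eq

lemma exists_delta_eq (hsigma : 0 < W.sigmaSq 0) (hlam : 0 < W.lamStar) {δ : ℝ} (h0 : 0 < δ)
    (h : (δ : EReal) < W.DeltaStar) :
    ∃ l : ℝ, 0 < l ∧ (l : EReal) < W.lamStar ∧ W.delta l = δ := by
  rw [W.DeltaStar_eq hsigma hlam] at h
  obtain ⟨⟨b, hb⟩, hδb⟩ := lt_iSup_iff.1 h
  have hδb' : δ < W.delta b := by exact_mod_cast hδb
  have hz : ((0 : ℝ) : EReal) < W.lamStar := by simpa using hlam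
  have hd0 := W.delta_zero hlam
  have hb0 : 0 < b := by
    by_contra hle
    have := (W.strictMonoOn_delta hsigma hlam).monotoneOn hb hz (not_lt.1 hle)
    rw [hd0] at this
    linarith
  have hc : ContinuousOn W.delta (Set.Icc 0 b) := fun l hl =>
    (W.hasDerivAt_delta (lt_of_le_of_lt (EReal.coe_le_coe_iff.2 hl.2)
      hb)).continuousAt.continuousWithinAt
  obtain ⟨l, hl, hlδ⟩ := intermediate_value_Ioo hb0.le hc ⟨by rw [hd0]; exact h0, hδb'⟩
  exact ⟨l, hl.1, lt_trans (EReal.coe_lt_coe_iff.2 hl.2) hb, hlδ⟩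

/-! ### The rate function -/

/-- The tangent-line inequality says that the supremum is attained at `l`; exponents with infinite
partition function contribute `⊥`. -/
lemma rateE_delta {l : ℝ} (hl0 : 0 ≤ l) (hl : (l : EReal) < W.lamStar) :
    W.rateE (W.delta l)
      = ((l * (W.condEntropy + W.delta l) - cgf W.info W.joint l : ℝ) : EReal) := by
  have hint := W.mem_interior_of_lt_lamStar hl
  refine le_antisymm (iSup_le fun b => ?_) ?_
  · by_cases hb : Integrable (fun z => Real.exp (b.1 * W.info z)) W.joint
    · rw [W.log_partition_eq hb, ← EReal.coe_sub, EReal.coe_le_coe_iff]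
      have := cgf_add_mul_le hint hb
      rw [← W.condEntropy_add_delta (integrable_exp_of_mem_interior hint)] at this
      linarith
    · have htop : W.partition b.1 = ⊤ := by
        by_contra hne
        exact hb ((W.partition_lt_top_iff _).1 (lt_top_iff_ne_top.2 hne))
      rw [htop, ENNReal.log_top, EReal.sub_top]
      exact bot_le
  · refine le_trans (le_of_eq ?_) (le_iSup _ ⟨l, hl0⟩)
    rw [W.log_partition_eq (integrable_exp_of_mem_interior hint), ← EReal.coe_sub]

lemma rate_delta {l : ℝ} (hl0 : 0 ≤ l) (hl : (l : EReal) < W.lamStar) :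
    W.rate (W.delta l) = l * (W.condEntropy + W.delta l) - cgf W.info W.joint l := by
  rw [rate, W.rateE_delta hl0 hl, EReal.toReal_coe]

lemma rate_delta_sub_le {l l' : ℝ} (hl0 : 0 ≤ l) (hl : (l : EReal) < W.lamStar) (hl0' : 0 ≤ l')
    (hl' : (l' : EReal) < W.lamStar) :
    l * (W.delta l' - W.delta l) ≤ W.rate (W.delta l') - W.rate (W.delta l) := by
  have hint := W.mem_interior_of_lt_lamStar hl
  have hint' := W.mem_interior_of_lt_lamStar hl'
  have := cgf_add_mul_le hint' (integrable_exp_of_mem_interior hint)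
  rw [← W.condEntropy_add_delta (integrable_exp_of_mem_interior hint')] at this
  rw [W.rate_delta hl0 hl, W.rate_delta hl0' hl']
  linarith

/-- Nearby arguments of the rate are values `delta b`. Applying `rate_delta_sub_le` both ways puts
the increment of the rate between `l` and `b` times the increment of `delta`, and `b` is within `ε`
of `l`. -/
lemma hasDerivAt_rate (hsigma : 0 < W.sigmaSq 0) (hlam : 0 < W.lamStar) {l : ℝ} (hl0 : 0 < l)
    (hl : (l : EReal) < W.lamStar) : HasDerivAt W.rate l (W.delta l) := by
  rw [hasDerivAt_iff_isLittleO, Asymptotics.isLittleO_iff]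
  intro ε hε
  have hnhds : {b : ℝ | (b : EReal) < W.lamStar} ∩ Set.Ioi 0 ∈ 𝓝 l :=
    inter_mem (W.isOpen_lt_lamStar.mem_nhds hl) (Ioi_mem_nhds hl0)
  obtain ⟨η, hη0, hη⟩ := Metric.nhds_basis_closedBall.mem_iff.1 hnhds
  set κ := min η ε with hκ
  have hκ0 : 0 < κ := lt_min hη0 hε
  have hmem : ∀ b ∈ Set.Icc (l - κ) (l + κ), (b : EReal) < W.lamStar ∧ 0 < b := fun b hb => by
    refine hη ?_
    rw [Real.closedBall_eq_Icc]
    have := min_le_left η ε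
    exact ⟨by linarith [hb.1], by linarith [hb.2]⟩
  have hm1 := hmem (l - κ) ⟨le_rfl, by linarith⟩
  have hm2 := hmem (l + κ) ⟨by linarith, le_rfl⟩
  have hmono := W.strictMonoOn_delta hsigma hlam
  have hc : ContinuousOn W.delta (Set.Icc (l - κ) (l + κ)) := fun b hb =>
    (W.hasDerivAt_delta (hmem b hb).1).continuousAt.continuousWithinAt
  have h1 : W.delta (l - κ) < W.delta l := hmono hm1.1 hl (by linarith)
  have h2 : W.delta l < W.delta (l + κ) := hmono hl hm2.1 (by linarith)
  filter_upwards [Ioo_mem_nhds h1 h2] with d hd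
  obtain ⟨b, hb, rfl⟩ := intermediate_value_Ioo (by linarith) hc hd
  have hb' := hmem b (Set.Ioo_subset_Icc_self hb)
  have e1 := W.rate_delta_sub_le hl0.le hl hb'.2.le hb'.1
  have e2 := W.rate_delta_sub_le hb'.2.le hb'.1 hl0.le hl
  rw [smul_eq_mul, Real.norm_eq_abs, Real.norm_eq_abs]
  have hbl : |b - l| ≤ ε := by
    rw [abs_le]
    have := min_le_right η ε
    constructor <;> linarith [hb.1, hb.2]
  calc |W.rate (W.delta b) - W.rate (W.delta l) - (W.delta b - W.delta l) * l|
      = W.rate (W.delta b) - W.rate (W.delta l) - (W.delta b - W.delta l) * l :=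
        abs_of_nonneg (by linarith)
    _ ≤ (b - l) * (W.delta b - W.delta l) := by linarith
    _ ≤ |b - l| * |W.delta b - W.delta l| := by
        rw [← abs_mul]
        exact le_abs_self _
    _ ≤ ε * |W.delta b - W.delta l| := by gcongr

end BIMC

namespace BIMC

open ProbabilityTheory

variable {Y : Type*} [MeasurableSpace Y] (W : BIMC Y)

/-! ### Word error probability of jar decoding -/

lemma thirdMoment_toReal_pos {l : ℝ} (h : l ∈ interior (integrableExpSet W.info W.joint))
    (hs : 0 < W.sigmaSq l) : 0 < (W.thirdMoment l).toReal := by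
  have hi := integrable_exp_of_mem_interior h
  refine ENNReal.toReal_nonneg.lt_of_ne fun h0 => ?_
  rw [W.thirdMoment_toReal_eq h, eq_comm, integral_eq_zero_iff_of_nonneg (fun z => by positivity)
    (integrable_abs_sub_pow_tilted h _ 3)] at h0
  rw [W.sigmaSq_eq hi] at hs
  refine hs.ne' (integral_eq_zero_of_ae ?_)
  filter_upwards [h0] with z hz
  have h1 : |W.info z - (W.condEntropy + W.delta l)| = 0 := pow_eq_zero_iff three_ne_zero |>.1 hz
  simp [h1]

/-- `Function.invFun` inverts only on the range of `gaussQ`, so the Berry-Esseen term must be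
positive. This is what positivity of `C` and of the third moment is needed for. -/
lemma gaussQ_rhoStar {C l : ℝ} {n : ℕ} (h : 0 < W.beTerm C l n) :
    gaussQ (W.rhoStar C l n) = min (W.beTerm C l n) (1 / 2) := by
  exact Function.invFun_eq (exists_gaussQ_eq (lt_min h (by norm_num)) (min_le_right _ _))

lemma rhoStar_nonneg {C l : ℝ} {n : ℕ} (h : 0 < W.beTerm C l n) : 0 ≤ W.rhoStar C l n := by
  rw [← strictAnti_gaussQ.le_iff_ge, gaussQ_zero, W.gaussQ_rhoStar h]
  exact min_le_right _ _

lemma xiBar_eq (C l : ℝ) (n : ℕ) :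
    W.xiBar C l n = 2 * W.beTerm C l n + Real.exp (n * l ^ 2 * W.sigmaSq l / 2)
      * (gaussQ (Real.sqrt n * l * Real.sqrt (W.sigmaSq l))
          - gaussQ (W.rhoStar C l n + Real.sqrt n * l * Real.sqrt (W.sigmaSq l))) := by
  rw [xiBar, beTerm, sigma]
  ring

lemma beTerm_pos {C l : ℝ} {n : ℕ} (hC : IsBerryEsseenConst C) (hn : 1 ≤ n)
    (h : l ∈ interior (integrableExpSet W.info W.joint)) (hs : 0 < W.sigmaSq l) :
    0 < W.beTerm C l n := by
  have h1 : 0 < C := (gaussQ_pos 1).trans_le (pos_of_isBerryEsseenConst hC)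
  have h2 := W.thirdMoment_toReal_pos h hs
  have h3 : 0 < W.sigma l := Real.sqrt_pos.2 hs
  have h4 : (0 : ℝ) < n := by exact_mod_cast hn
  rw [beTerm]
  positivity

lemma xiBar_pos {C l : ℝ} {n : ℕ} (h : 0 < W.beTerm C l n) : 0 < W.xiBar C l n := by
  have h1 : gaussQ (W.rhoStar C l n + Real.sqrt n * l * Real.sqrt (W.sigmaSq l))
      ≤ gaussQ (Real.sqrt n * l * Real.sqrt (W.sigmaSq l)) :=
    strictAnti_gaussQ.antitone (le_add_of_nonneg_left (W.rhoStar_nonneg h))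
  rw [xiBar_eq]
  have := mul_nonneg (Real.exp_pos (n * l ^ 2 * W.sigmaSq l / 2)).le (sub_nonneg.2 h1)
  linarith

theorem pi_joint_real_info_gt_le {C : ℝ} (hC : IsBerryEsseenConst C)
    (hsigma : 0 < W.sigmaSq 0) (hlam : 0 < W.lamStar) {l : ℝ} (hl0 : 0 < l)
    (hl : (l : EReal) < W.lamStar) {n : ℕ} (hn : 1 ≤ n) :
    (Measure.pi fun _ : Fin n => W.joint).real
        {z | n * (W.condEntropy + W.delta l) < ∑ i, W.info (z i)}
      ≤ W.xiBar C l n * Real.exp (-n * W.rate (W.delta l)) := by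
  have h := W.mem_interior_of_lt_lamStar hl
  have hi := integrable_exp_of_mem_interior h
  have hs := W.sigmaSq_pos hsigma hlam h
  have hB := W.beTerm_pos hC hn h hs
  rw [W.rate_delta hl0.le hl, xiBar_eq]
  refine pi_real_sum_gt_le hC W.measurable_info hl0 hi (integrable_tilted_of_mem_interior h)
    (integrable_abs_sub_pow_tilted h _ 3) (W.condEntropy_add_delta hi) (W.sigmaSq_eq hi) hs
    (W.thirdMoment_toReal_eq h) hn rfl (W.rhoStar_nonneg hB) ?_
  rw [W.gaussQ_rhoStar hB]
  exact min_le_left _ _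

theorem pi_joint_real_info_gt_le_gaussQ {C : ℝ} (hC : IsBerryEsseenConst C)
    (hsigma : 0 < W.sigmaSq 0) (hlam : 0 < W.lamStar) {n : ℕ} (hn : 1 ≤ n) (c : ℝ) :
    (Measure.pi fun _ : Fin n => W.joint).real
        {z | n * (W.condEntropy + c / Real.sqrt n) < ∑ i, W.info (z i)}
      ≤ gaussQ (c / W.sigma 0) + W.beTerm C 0 n := by
  have h := W.zero_lt_lamStar_mem hlam
  have hi := integrable_exp_of_mem_interior h
  have hd := W.delta_zero hlam
  have hm := W.condEntropy_add_delta hi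
  have hs := W.sigmaSq_eq hi
  have h3 := W.thirdMoment_toReal_eq h
  have hX := integrable_tilted_of_mem_interior h
  have hX3 := integrable_abs_sub_pow_tilted h W.condEntropy 3
  simp only [zero_mul, tilted_const, hd, add_zero] at hm hs h3 hX hX3
  have hn0 : (0 : ℝ) < n := by exact_mod_cast hn
  have hsn : 0 < Real.sqrt n := Real.sqrt_pos.2 hn0
  have hσ : 0 < W.sigma 0 := Real.sqrt_pos.2 hsigma
  have key := hC.abs_sub_le W.measurable_info hX (by rw [← hm]; exact hX3)
    (by rw [← hm, ← hs]; exact hsigma) hn (c / W.sigma 0)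
  rw [← hm, ← hs, ← h3] at key
  have hset : {z : Fin n → ZMod 2 × Y | n * (W.condEntropy + c / Real.sqrt n) < ∑ i, W.info (z i)}
      = {z | c / W.sigma 0 < (∑ i, (W.info (z i) - W.condEntropy))
          / (Real.sqrt n * Real.sqrt (W.sigmaSq 0))} := by
    ext z
    simp only [Set.mem_ofPred_eq]
    have e1 : c / W.sigma 0 * (Real.sqrt n * W.sigma 0) = c * Real.sqrt n := by field_simp
    have e2 : n * (c / Real.sqrt n) = c * Real.sqrt n := by
      nth_rw 1 [← Real.mul_self_sqrt hn0.le]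
      field_simp
    rw [← sigma, lt_div_iff₀ (by positivity), e1, mul_add, e2, Finset.sum_sub_distrib]
    simp only [Finset.sum_const, Finset.card_univ, Fintype.card_fin, nsmul_eq_mul]
    exact lt_sub_iff_add_lt'.symm
  rw [hset]
  have := (abs_le.1 key).2
  rw [beTerm, sigma]
  rw [sigma] at this
  linarith

lemma inv_two_pow_sub_eq {n k : ℕ} (hk : 1 ≤ k) (hkn : k ≤ n) :
    ((2 : ℝ) ^ (n - k))⁻¹ = Real.exp (n * (designRate n k - Real.log 2)) := by
  have hn0 : (n : ℝ) ≠ 0 := by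
    have : n ≠ 0 := by omega
    exact_mod_cast this
  have h1 : n * (designRate n k - Real.log 2) = -(((n - k : ℕ) : ℝ) * Real.log 2) := by
    rw [designRate, Nat.cast_sub hkn]
    field_simp
    ring
  rw [h1, Real.exp_neg, Real.exp_nat_mul, Real.exp_log two_pos]

lemma inv_two_pow_sub_mul_exp_le {n k : ℕ} (hk : 1 ≤ k) (hkn : k ≤ n) {d a : ℝ}
    (h : designRate n k ≤ W.linCapacity - d + a / n) :
    ((2 : ℝ) ^ (n - k))⁻¹ * Real.exp (n * (W.condEntropy + d)) ≤ Real.exp a := by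
  have hn0 : (0 : ℝ) < n := by
    have : 0 < n := by omega
    exact_mod_cast this
  rw [inv_two_pow_sub_eq hk hkn, ← Real.exp_add, Real.exp_le_exp, ← mul_add]
  rw [linCapacity] at h
  calc _ ≤ n * (a / n) := by gcongr; linarith
    _ = a := by field_simp

end BIMC

/-! ### Assembly of the tail and jar-size bounds -/

lemma one_le_one_div_one_sub_two_rpow {n : ℕ} (hn : 1 ≤ n) :
    (1 : ℝ) ≤ 1 / (1 - 2 ^ (-(n : ℝ))) := by
  have h0 : (0 : ℝ) < 2 ^ (-(n : ℝ)) := by positivity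
  have h1 : (2 : ℝ) ^ (-(n : ℝ)) < 1 :=
    Real.rpow_lt_one_of_one_lt_of_neg one_lt_two (by
      have : (0 : ℝ) < n := by exact_mod_cast hn
      linarith)
  rw [le_div_iff₀ (by linarith)]
  linarith

end

theorem theorem2 {Y : Type*} [MeasurableSpace Y] (W : BIMC Y)
    (hsigma : 0 < W.sigmaSq 0) (hlam : 0 < W.lamStar) (hM : W.thirdMoment 0 < ⊤)
    (C : ℝ) (hC : berryEsseenConst ≤ C)
    (n k : ℕ) (hk : 1 ≤ k) (hkn : k ≤ n) :
    -- the limit defining `Δ*` exists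
    Tendsto (fun l : ℝ => (W.delta l : EReal)) W.toLamStar (𝓝 W.DeltaStar) ∧
    -- part 1, with `λ = r'(δ)`
    (∀ δ : ℝ, 0 < δ → (δ : EReal) < W.DeltaStar →
      W.rateE δ < ⊤ ∧ DifferentiableAt ℝ W.rate δ ∧
      0 < deriv W.rate δ ∧ ((deriv W.rate δ : ℝ) : EReal) < W.lamStar ∧
      (designRate n k ≤ W.linCapacity - δ - W.rate δ
          + Real.log (deriv W.rate δ * W.xiBar C (deriv W.rate δ) n) / n →
        ∀ g : Decoder Y (n - k) n, W.IsJarDecoder δ g →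
          W.avgError g ≤ (1 / (1 - 2 ^ (-(n : ℝ))) + deriv W.rate δ)
            * W.xiBar C (deriv W.rate δ) n * Real.exp (-n * W.rate δ))) ∧
    -- part 2
    (∀ c : ℝ,
      designRate n k ≤ W.linCapacity - c / Real.sqrt n - Real.log n / (2 * n)
          - (c ^ 2 / (2 * W.sigmaSq 0) + Real.log (Real.sqrt (2 * Real.pi) * W.sigma 0)) / n →
        ∀ g : Decoder Y (n - k) n, W.IsJarDecoder (c / Real.sqrt n) g →
          W.avgError g ≤ 1 / (1 - 2 ^ (-(n : ℝ))) * gaussQ (c / W.sigma 0)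
            + 1 / Real.sqrt n
              * (C * (W.thirdMoment 0).toReal / W.sigma 0 ^ 3
                + Real.exp (-c ^ 2 / (2 * W.sigmaSq 0))
                  / (Real.sqrt (2 * Real.pi) * W.sigma 0))) := by
  have hBE := isBerryEsseenConst_of_berryEsseenConst_le hC
  have hn : 1 ≤ n := hk.trans hkn
  have hn0 : (0 : ℝ) < n := by exact_mod_cast hn
  have hnk : n - k < n := by omega
  have hfac := one_le_one_div_one_sub_two_rpow hn
  refine ⟨?_, fun δ hδ0 hδ => ?_, fun c hR g hg => ?_⟩
  · rw [W.DeltaStar_eq hsigma hlam]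
    exact W.tendsto_delta hsigma hlam
  · obtain ⟨l, hl0, hl, rfl⟩ := W.exists_delta_eq hsigma hlam hδ0 hδ
    have hder := W.hasDerivAt_rate hsigma hlam hl0 hl
    have hint := W.mem_interior_of_lt_lamStar hl
    rw [hder.deriv]
    refine ⟨?_, hder.differentiableAt, hl0, hl, fun hR g hg => ?_⟩
    · rw [W.rateE_delta hl0.le hl]
      exact EReal.coe_lt_top _
    · have hξ := W.xiBar_pos (W.beTerm_pos hBE hn hint (W.sigmaSq_pos hsigma hlam hint))
      have h1 := W.pi_joint_real_info_gt_le hBE hsigma hlam hl0 hl hn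
      -- The rate condition makes the jar-size term at most `l * xiBar * exp (-n r)`, that is, `l`
      -- times the bound for the tail term.
      have h2 := W.inv_two_pow_sub_mul_exp_le hk hkn (d := W.delta l)
        (a := Real.log (l * W.xiBar C l n) + -n * W.rate (W.delta l)) (by
          refine hR.trans (le_of_eq ?_)
          field_simp
          ring)
      rw [Real.exp_add, Real.exp_log (by positivity)] at h2
      -- `avgError_le` has coefficient 1 on the tail term; the puncturing factor is at least 1 and
      -- only weakens it.
      have h3 : W.xiBar C l n * Real.exp (-n * W.rate (W.delta l))
          ≤ 1 / (1 - 2 ^ (-(n : ℝ)))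
            * (W.xiBar C l n * Real.exp (-n * W.rate (W.delta l))) :=
        le_mul_of_one_le_left (by positivity) hfac
      linarith [W.avgError_le hnk hg]
  · have hσ : 0 < W.sigma 0 := Real.sqrt_pos.2 hsigma
    have h1 := W.pi_joint_real_info_gt_le_gaussQ hBE hsigma hlam hn c
    -- Here the exponent is the logarithm of the Gaussian density term `exp (-c² / (2 σ²)) / (√(2π)
    -- σ √n)`; the `√n` comes from `ln n / (2 n)` in the rate.
    have h2 := W.inv_two_pow_sub_mul_exp_le hk hkn (d := c / Real.sqrt n)
      (a := -c ^ 2 / (2 * W.sigmaSq 0) - Real.log (Real.sqrt (2 * Real.pi) * W.sigma 0)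
        - Real.log n / 2) (by
          refine hR.trans (le_of_eq ?_)
          field_simp
          ring)
    rw [Real.exp_sub, Real.exp_sub, Real.exp_log (by positivity), ← Real.log_sqrt hn0.le,
      Real.exp_log (Real.sqrt_pos.2 hn0)] at h2
    have h3 : gaussQ (c / W.sigma 0) ≤ 1 / (1 - 2 ^ (-(n : ℝ))) * gaussQ (c / W.sigma 0) :=
      le_mul_of_one_le_left (gaussQ_pos _).le hfac
    have h4 : 1 / Real.sqrt n
              * (C * (W.thirdMoment 0).toReal / W.sigma 0 ^ 3
                + Real.exp (-c ^ 2 / (2 * W.sigmaSq 0))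
                  / (Real.sqrt (2 * Real.pi) * W.sigma 0))
        = W.beTerm C 0 n + Real.exp (-c ^ 2 / (2 * W.sigmaSq 0))
                  / (Real.sqrt (2 * Real.pi) * W.sigma 0) / Real.sqrt n := by
      rw [BIMC.beTerm]
      field_simp
    linarith [W.avgError_le hnk hg]
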